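/- Let $n\ge 2$, let $k$ be a field of characteristic $2$, and let $E=k(\alpha_0,\dots,\alpha_n)$ be the field of rational functions in $n+1$ independent variables over $k$. Notation, over a field $F$ of characteristic $2$. $[a,b]$ is the quadratic form $au^2+uv+bv^2$. For $\beta_1,\dots,\beta_m\in F^\times$, the bilinear $m$-fold Pfister form $\langle\langle\beta_1,\dots,\beta_m\rangle\rangle$ is $\langle 1,\beta_1\rangle\otimes\cdots\otimes\langle 1,\beta_m\rangle$. A quadratic $m$-fold Pfister form ($m\ge1$) is a form isometric to $$\langle\langle \beta_1,\dots,\beta_{m-1},a]]=\langle\langle\beta_1,\dots,\beta_{m-1}\rangle\rangle\otimes[1,a],\qquad \beta_j\in F^\times,\ a\in F.$$ For $a_1,\dots,a_m\in F^\times$ put $((a_1,\dots,a_m))=\langle\langle a_1,\dots,a_{m-1},a_1a_2\cdots a_m]]$. A form $\rho$ is a subform of $\varphi$ if it is isometric to the restriction of $\varphi$ to a subspace; a bilinear $1$-fold Pfister form $\langle\langle\beta\rangle\rangle$ is here viewed as the quadratic form $u^2+\beta v^2$. A set of quadratic $m$-fold Pfister forms is strongly tight if every element of the subgroup that it generates in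 the Witt group $I_qF$ of even-dimensional nonsingular quadratic forms is the class of a quadratic $m$-fold Pfister form. For $m\ge2$, it is left-linked if there is a bilinear $(m-1)$-fold Pfister form $b$ such that each form of the set is isometric to $b\otimes[1,a]$ for some $a\in F$, and right-linked if there is a quadratic $(m-1)$-fold Pfister form $\varphi$ such that each form of the set is isometric to $\langle\langle\beta\rangle\rangle\otimes\varphi$ for some $\beta\in F^\times$. Theorem. For $0\le i\le n$ let $$\psi_i=((\alpha_0,\dots,\alpha_{i-1},\alpha_{i+1},\dots,\alpha_n)).$$ Then $\psi_0,\dots,\psi_n$ are $n+1$ pairwise non-isometric quadratic $n$-fold Pfister forms over $E$, and the set $\{\psi_0,\dots,\psi_n\}$ is strongly tight. However, there is no quadratic $1$-fold Pfister form $[1,a]$ with $a\in E$ that is a subform of every $\psi_i$, and no bilinear $1$-fold Pfister form $\langle\langle\beta\rangle\rangle$ with $\beta\in E^\times$ that is a subform of every $\psi_i$. In particular, $\{\psi_0,\dots,\psi_n\}$ is neither left-linked nor right-linked. -/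

import Mathlib

universe u

noncomputable section

namespace PfisterLinkage

/-- A nonsingular quadratic space of finite even dimension over a field `F`: a quadratic form whose
polar bilinear form `(x, y) ↦ q (x + y) - q x - q y` is nondegenerate. Every such space is isometric
to one on some `Fin d → F`, so restricting the underlying vector space to the universe of `F` loses
nothing. -/
structure QuadSpace (F : Type u) [Field F] : Type (u + 1) where
  V : Type u
  [addCommGroup : AddCommGroup V]
  [module : Module F V]
  [finiteDimensional : FiniteDimensional F V]
  form : QuadraticForm F V
  nonsingular : (QuadraticMap.polarBilin form).Nondegenerate
  even_finrank : Even (Module.finrank F V)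

attribute [instance] QuadSpace.addCommGroup QuadSpace.module QuadSpace.finiteDimensional

/-- Since the polar form is symmetric, nondegeneracy only needs to be checked on one side. -/
theorem nondegenerate_of_left {F V : Type*} [Field F] [AddCommGroup V] [Module F V]
    (Q : QuadraticForm F V) (h : ∀ x, (∀ y, QuadraticMap.polar Q x y = 0) → x = 0) :
    (QuadraticMap.polarBilin Q).Nondegenerate :=
  ⟨fun x hx => h x hx, fun y hy => h y fun x => by
    rw [QuadraticMap.polar_comm]; exact hy x⟩

section General

variable {F : Type u} [Field F]

/-- Two quadratic spaces are isometric. -/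
def QuadSpace.Isometric (A B : QuadSpace F) : Prop :=
  QuadraticMap.Equivalent A.form B.form

instance quadSpaceSetoid (F : Type u) [Field F] : Setoid (QuadSpace F) where
  r := QuadSpace.Isometric
  iseqv :=
    { refl := fun A => QuadraticMap.Equivalent.refl A.form
      symm := fun h => QuadraticMap.Equivalent.symm h
      trans := fun h h' => QuadraticMap.Equivalent.trans h h' }

/-- The orthogonal sum `A ⊥ B`. -/
def QuadSpace.orthSum (A B : QuadSpace F) : QuadSpace F where
  V := A.V × B.V
  form := A.form.prod B.form
  nonsingular := by
    refine nondegenerate_of_left _ fun x hx => ?_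
    refine Prod.ext (A.nonsingular.1 x.1 fun y => ?_) (B.nonsingular.1 x.2 fun y => ?_)
    · simpa [QuadraticMap.polar_zero_right] using hx (y, 0)
    · simpa [QuadraticMap.polar_zero_right] using hx (0, y)
  even_finrank := by
    rw [Module.finrank_prod]
    exact A.even_finrank.add B.even_finrank

/-- The zero-dimensional space. -/
def QuadSpace.zero (F : Type u) [Field F] : QuadSpace F where
  V := PUnit.{u + 1}
  form := 0
  nonsingular := nondegenerate_of_left _ fun _ _ => rfl
  even_finrank := by rw [Module.finrank_zero_of_subsingleton]; exact Even.zero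

/-- The binary form `[a, b]`, that is, `a u₁² + u₁ u₂ + b u₂²`. -/
def binaryForm (a b : F) : QuadraticForm F (F × F) :=
  a • QuadraticMap.sq.comp (LinearMap.fst F F F)
    + QuadraticMap.linMulLin (LinearMap.fst F F F) (LinearMap.snd F F F)
    + b • QuadraticMap.sq.comp (LinearMap.snd F F F)

theorem binaryForm_apply (a b : F) (x : F × F) :
    binaryForm a b x = a * x.1 ^ 2 + x.1 * x.2 + b * x.2 ^ 2 := by
  simp [binaryForm, sq]

/-- The hyperbolic plane `(u₁, u₂) ↦ u₁ u₂`. -/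
def QuadSpace.hyperbolicPlane (F : Type u) [Field F] : QuadSpace F where
  V := F × F
  form := binaryForm 0 0
  nonsingular := by
    refine nondegenerate_of_left _ fun x hx => ?_
    have h1 := hx (1, 0)
    have h2 := hx (0, 1)
    simp only [QuadraticMap.polar, binaryForm_apply, Prod.fst_add, Prod.snd_add] at h1 h2
    exact Prod.ext (by simpa [mul_add] using h2) (by simpa [add_mul] using h1)
  even_finrank := by simp

/-- Isometry classes of nonsingular even-dimensional quadratic forms over `F`. -/
def IsometryClass (F : Type u) [Field F] : Type (u + 1) :=
  Quotient (quadSpaceSetoid F)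

/-- The isometry class of a quadratic space. -/
def isometryClass (A : QuadSpace F) : IsometryClass F :=
  Quotient.mk (quadSpaceSetoid F) A

instance (F : Type u) [Field F] : Add (IsometryClass F) where
  add := Quotient.map₂ QuadSpace.orthSum fun _ _ h _ _ h' => QuadraticMap.Equivalent.prod h h'

instance (F : Type u) [Field F] : Zero (IsometryClass F) where
  zero := isometryClass (QuadSpace.zero F)

/-- Isometry classes form a commutative monoid under orthogonal sum. -/
instance (F : Type u) [Field F] : AddCommMonoid (IsometryClass F) where
  nsmul := nsmulRec
  add_assoc := by
    rintro ⟨A⟩ ⟨B⟩ ⟨C⟩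
    exact Quotient.sound
      ⟨{ LinearEquiv.prodAssoc F A.V B.V C.V with map_app' := fun x => (add_assoc _ _ _).symm }⟩
  zero_add := by
    rintro ⟨A⟩
    exact Quotient.sound
      ⟨{ LinearEquiv.uniqueProd (R := F) (M := A.V) (M₂ := PUnit.{u + 1}) with
          map_app' := fun x => (zero_add (A.form x.2)).symm }⟩
  add_zero := by
    rintro ⟨A⟩
    exact Quotient.sound
      ⟨{ LinearEquiv.prodUnique (R := F) (M := A.V) (M₂ := PUnit.{u + 1}) with
          map_app' := fun x => (add_zero (A.form x.1)).symm }⟩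
  add_comm := by
    rintro ⟨A⟩ ⟨B⟩
    exact Quotient.sound ⟨QuadraticMap.IsometryEquiv.prodComm A.form B.form⟩

/-- The quadratic Witt group `I_q F = I_q¹ F` of Witt classes of nonsingular even-dimensional
quadratic forms: the Grothendieck group of the monoid of isometry classes under orthogonal sum,
modulo the subgroup generated by the hyperbolic plane. By Witt decomposition and cancellation, two
forms have the same class in it if and only if their anisotropic parts are isometric. -/
abbrev WittGroup (F : Type u) [Field F] : Type (u + 1) :=
  Algebra.GrothendieckAddGroup (IsometryClass F) ⧸
    AddSubgroup.zmultiples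
      (Algebra.GrothendieckAddGroup.of (isometryClass (QuadSpace.hyperbolicPlane F)))

/-- The Witt class of a nonsingular even-dimensional quadratic form. -/
def wittClass (A : QuadSpace F) : WittGroup F :=
  QuotientAddGroup.mk (Algebra.GrothendieckAddGroup.of (isometryClass A))

/-- `ρ` is a subform of `A`: it is isometric to the restriction of `A` to a subspace. -/
def IsSubform {W : Type*} [AddCommGroup W] [Module F W] (ρ : QuadraticForm F W)
    (A : QuadSpace F) : Prop :=
  ∃ f : ρ →qᵢ A.form, Function.Injective f

/-- The diagonal entries of the bilinear Pfister form
`⟨⟨β₁, …, βₘ⟩⟩ = ⟨1, β₁⟩ ⊗ ⋯ ⊗ ⟨1, βₘ⟩`: the products of the subfamilies of `β₁, …, βₘ`. -/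
def pfisterEntry {m : ℕ} (β : Fin m → Fˣ) (s : Finset (Fin m)) : Fˣ :=
  ∏ j ∈ s, β j

/-- The bilinear `m`-fold Pfister form `⟨⟨β₁, …, βₘ⟩⟩`, as a diagonal bilinear form. -/
def bilinearPfister {m : ℕ} (β : Fin m → Fˣ) : LinearMap.BilinForm F (Finset (Fin m) → F) :=
  Matrix.toBilin' (Matrix.diagonal fun s => (pfisterEntry β s : F))

/-- The tensor product `⟨⟨β₁, …, βₘ⟩⟩ ⊗ φ` of a bilinear Pfister form and a quadratic form: the
orthogonal sum of the forms `d φ` over the diagonal entries `d` of `⟨⟨β₁, …, βₘ⟩⟩`. -/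
def QuadSpace.pfisterTensor {m : ℕ} (β : Fin m → Fˣ) (A : QuadSpace F) : QuadSpace F where
  V := Finset (Fin m) → A.V
  form := QuadraticMap.pi fun s => (pfisterEntry β s : F) • A.form
  nonsingular := by
    classical
    refine nondegenerate_of_left _ fun x hx => funext fun s => A.nonsingular.1 (x s) fun y => ?_
    have h := hx (Pi.single s y)
    simp only [QuadraticMap.polar, QuadraticMap.pi_apply, smul_apply, smul_eq_mul,
      Pi.add_apply, ← Finset.sum_sub_distrib, ← mul_sub] at h
    rw [Finset.sum_eq_single s (fun t _ ht => by simp [Pi.single_eq_of_ne ht]) (by simp)] at h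
    simpa [QuadraticMap.polar] using h
  even_finrank := by
    rw [Module.finrank_pi_fintype, Finset.sum_const, smul_eq_mul]
    exact A.even_finrank.mul_left _

end General

section CharTwo

variable {F : Type u} [Field F] [CharP F 2]

/-- The quadratic 1-fold Pfister form `⟨⟨a]] = [1, a]` in characteristic two. -/
def quadraticOnePfister (a : F) : QuadSpace F where
  V := F × F
  form := binaryForm 1 a
  nonsingular := by
    refine nondegenerate_of_left _ fun x hx => ?_
    have h2F : (2 : F) = 0 := CharTwo.two_eq_zero
    have h1 := hx (1, 0)
    have h2 := hx (0, 1)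
    simp only [QuadraticMap.polar, binaryForm_apply, Prod.fst_add, Prod.snd_add] at h1 h2
    refine Prod.ext ?_ ?_
    · show x.1 = 0
      linear_combination h2 - a * x.2 * h2F
    · show x.2 = 0
      linear_combination h1 - x.1 * h2F
  even_finrank := by simp

/-- The quadratic `(m + 1)`-fold Pfister form `⟨⟨β₁, …, βₘ, a]] = ⟨⟨β₁, …, βₘ⟩⟩ ⊗ [1, a]`. -/
def quadraticPfister {m : ℕ} (β : Fin m → Fˣ) (a : F) : QuadSpace F :=
  (quadraticOnePfister a).pfisterTensor β

/-- `A` is (isometric to) a quadratic `n`-fold Pfister form, where `n ≥ 1`. -/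
def IsPfister (n : ℕ) (A : QuadSpace F) : Prop :=
  ∃ m : ℕ, m + 1 = n ∧ ∃ (β : Fin m → Fˣ) (a : F), A.Isometric (quadraticPfister β a)

open Classical in
/-- The symbol `((α₁, …, αₙ))` for `n ≥ 1`: the quadratic `n`-fold Pfister form
`⟨⟨α₁, …, αₙ₋₁, α₁ ⋯ αₙ]]` if `α₁, …, αₙ₋₁` are nonzero, and the hyperbolic `n`-fold Pfister form
otherwise. -/
def symbol {n : ℕ} (α : Fin n → F) : QuadSpace F :=
  if h : ∀ j : Fin (n - 1), α (Fin.castLE (Nat.sub_le n 1) j) ≠ 0 then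
    quadraticPfister (fun j => Units.mk0 _ (h j)) (∏ j, α j)
  else
    quadraticPfister (fun _ : Fin (n - 1) => (1 : Fˣ)) 0

/-- A set of quadratic `n`-fold Pfister forms is strongly tight if every element of the subgroup it
generates in the Witt group is the class of a quadratic `n`-fold Pfister form. -/
def IsStronglyTight (n : ℕ) (S : Set (QuadSpace F)) : Prop :=
  (∀ A ∈ S, IsPfister n A) ∧
    ∀ w ∈ AddSubgroup.closure (wittClass '' S), ∃ P : QuadSpace F, IsPfister n P ∧ wittClass P = w

/-- A set of quadratic `(m + k)`-fold Pfister forms is `k`-right-linked if some quadratic `k`-fold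
Pfister form is a right divisor of all its elements. -/
def IsRightLinked (m k : ℕ) (S : Set (QuadSpace F)) : Prop :=
  ∃ φ : QuadSpace F, IsPfister k φ ∧
    ∀ A ∈ S, ∃ β : Fin m → Fˣ, A.Isometric (φ.pfisterTensor β)

/-- A set of quadratic `(m + k)`-fold Pfister forms is `m`-left-linked if some bilinear `m`-fold
Pfister form is a left divisor of all its elements. -/
def IsLeftLinked (m k : ℕ) (S : Set (QuadSpace F)) : Prop :=
  ∃ β : Fin m → Fˣ,
    ∀ A ∈ S, ∃ φ : QuadSpace F, IsPfister k φ ∧ A.Isometric (φ.pfisterTensor β)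

end CharTwo

/-- The field `k(α₀, …, αₙ)` of rational functions in `n + 1` independent variables. -/
abbrev RatFunField (k : Type u) [Field k] (n : ℕ) : Type u :=
  FractionRing (MvPolynomial (Fin (n + 1)) k)

/-- The variable `αᵢ` of `k(α₀, …, αₙ)`. -/
def ratVar (k : Type u) [Field k] (n : ℕ) (i : Fin (n + 1)) : RatFunField k n :=
  algebraMap (MvPolynomial (Fin (n + 1)) k) (RatFunField k n) (MvPolynomial.X i)

/-- The form `ψᵢ = ((α₀, …, αᵢ₋₁, αᵢ₊₁, …, αₙ))` over `k(α₀, …, αₙ)`. -/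
def omitForm (k : Type u) [Field k] [CharP k 2] (n : ℕ) (i : Fin (n + 1)) :
    QuadSpace (RatFunField k n) :=
  symbol fun j : Fin n => ratVar k n (i.succAbove j)

end PfisterLinkage

end

/-!
In the Witt group, `((a₁, …, aₙ))` is an alternating `ℤ`-multilinear function of its entries, with
values killed by two (`symbolClass`). It is additive in the last entry because
`d [1, a] ⊥ d [1, b] ≅ d [1, a + b] ⊥ ℍ`, and exchanging any entry with the last one does not change
it (`wittClass_symbol_swap_last`), because `∏ aᵢ` is a similarity factor of `[1, ∏ aᵢ]`. The forms
`ψᵢ` are the values at the `n`-element subfamilies of `α₀, …, αₙ`. An `n`-vector in a space of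
dimension `n + 1` is decomposable, so every sum of classes `ψᵢ` is the class of a single symbol
(`exists_eq_sum_succAbove`), which is strong tightness.

For the remaining assertions, order the monomials of `k[α₀, …, αₙ]` lexicographically. In a diagonal
presentation of `ψᵢ`, the coefficients of the squares are monomials whose exponents are distinct
modulo two and vanish at `i`, while each mixed term `u v` is dominated by the two squares next to
it. Hence no leading terms cancel: a nonzero vector has a nonzero value, the leading coefficient of a
polynomial value is a square, and its leading exponent is even at `i` (`leadingTerm_of_eq_form`).
Parity alone tells the `ψᵢ` apart, since `ψᵢ` represents the product of the variables other than
`αᵢ`.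

A binary form contained in every `ψᵢ` would represent all polynomials `p + u r + u²`, with `r = q`
for `[1, p / q²]` and with `r = 0` for `⟨⟨p / q²⟩⟩`. Each of them then has a leading term
`c² x^{2δ}`. Replacing `u` by `u + c x^δ` lowers the degree; if `r = q`, this uses that `ψᵢ` takes
values large in comparison to its polar form (`degree_polar_lt`). Monomial orders are well-founded,
so this is impossible (`no_descent`). Linkage on either side would provide such a common binary
subform.
-/

namespace PfisterLinkage

noncomputable section

/-! ### Classes in the Witt group -/

section WittClasses

variable {F : Type u} [Field F]

theorem wittClass_eq_of_isometric {A B : QuadSpace F} (h : A.Isometric B) :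
    wittClass A = wittClass B := by
  have : isometryClass A = isometryClass B := Quotient.sound h
  rw [wittClass, wittClass, this]

theorem wittClass_orthSum (A B : QuadSpace F) :
    wittClass (A.orthSum B) = wittClass A + wittClass B := by
  have : isometryClass (A.orthSum B) = isometryClass A + isometryClass B := rfl
  rw [wittClass, this, map_add, QuotientAddGroup.mk_add]; rfl

theorem wittClass_zero : wittClass (QuadSpace.zero F) = 0 := by
  have : isometryClass (QuadSpace.zero F) = 0 := rfl
  rw [wittClass, this, map_zero, QuotientAddGroup.mk_zero]

theorem wittClass_hyperbolicPlane : wittClass (QuadSpace.hyperbolicPlane F) = 0 :=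
  (QuotientAddGroup.eq_zero_iff _).2 (AddSubgroup.mem_zmultiples _)

/-- A form-preserving linear map out of a nonsingular space is injective, hence an isometry as soon
as the dimensions agree. -/
theorem isometric_of_linearMap {A B : QuadSpace F} (f : A.V →ₗ[F] B.V)
    (hf : ∀ x, B.form (f x) = A.form x)
    (hd : Module.finrank F A.V = Module.finrank F B.V) : A.Isometric B := by
  have hinj : Function.Injective f := by
    rw [← LinearMap.ker_eq_bot, LinearMap.ker_eq_bot']
    intro x hx
    refine A.nonsingular.1 x fun y => ?_
    have h : QuadraticMap.polar A.form x y = 0 := by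
      rw [QuadraticMap.polar, ← hf, ← hf, ← hf, map_add, hx]
      simp
    simpa using h
  exact ⟨{ LinearEquiv.ofInjectiveOfFinrankEq f hinj hd with map_app' := hf }⟩

/-- The orthogonal sum of a finite family of quadratic spaces. -/
def QuadSpace.pi {ι : Type} [Fintype ι] (A : ι → QuadSpace F) : QuadSpace F where
  V := ∀ i, (A i).V
  form := QuadraticMap.pi fun i => (A i).form
  nonsingular := by
    classical
    refine nondegenerate_of_left _ fun x hx => funext fun s => (A s).nonsingular.1 (x s) fun y => ?_
    have h := hx (Pi.single s y)
    simp only [QuadraticMap.polar, QuadraticMap.pi_apply,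
      Pi.add_apply, ← Finset.sum_sub_distrib] at h
    rw [Finset.sum_eq_single s (fun t _ ht => by simp [Pi.single_eq_of_ne ht]) (by simp)] at h
    simpa [QuadraticMap.polar] using h
  even_finrank := by
    rw [Module.finrank_pi_fintype]
    exact Finset.even_sum _ fun i _ => (A i).even_finrank

theorem QuadSpace.pi_form_apply {ι : Type} [Fintype ι] (A : ι → QuadSpace F)
    (x : ∀ i, (A i).V) : (QuadSpace.pi A).form x = ∑ i, (A i).form (x i) :=
  QuadraticMap.pi_apply _ _

theorem QuadSpace.pfisterTensor_form_apply {m : ℕ} (β : Fin m → Fˣ) (A : QuadSpace F)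
    (x : Finset (Fin m) → A.V) :
    (A.pfisterTensor β).form x = ∑ s, (pfisterEntry β s : F) * A.form (x s) :=
  QuadraticMap.pi_apply _ _

theorem wittClass_pi {ι : Type} [Fintype ι] (A : ι → QuadSpace F) :
    wittClass (QuadSpace.pi A) = ∑ i, wittClass (A i) := by
  revert A
  refine Fintype.induction_empty_option
    (P := fun (ι : Type) [Fintype ι] => ∀ A : ι → QuadSpace F,
      wittClass (QuadSpace.pi A) = ∑ i, wittClass (A i)) ?_ ?_ ?_ ι
  · intro α β _ e h A
    let := Fintype.ofEquiv β e.symm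
    rw [← e.sum_comp, ← h fun i => A (e i)]
    refine wittClass_eq_of_isometric (QuadraticMap.Equivalent.symm ⟨{
      LinearEquiv.piCongrLeft F (fun i => (A i).V) e with map_app' := fun x => ?_ }⟩)
    refine (QuadSpace.pi_form_apply A _).trans (Eq.trans ?_ (QuadSpace.pi_form_apply _ x).symm)
    rw [← e.sum_comp]
    refine Finset.sum_congr rfl fun i _ => ?_
    congr 1
    exact Equiv.piCongrLeft_apply_apply (fun i => (A i).V) e x i
  · intro A
    rw [Fintype.sum_empty, ← wittClass_zero]
    exact wittClass_eq_of_isometric (isometric_of_linearMap 0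
      (fun x => (QuadSpace.pi_form_apply A x).symm)
      (by
        have : Subsingleton (QuadSpace.pi A).V := inferInstanceAs (Subsingleton (∀ i, (A i).V))
        have : Subsingleton (QuadSpace.zero F).V := inferInstanceAs (Subsingleton PUnit)
        rw [Module.finrank_zero_of_subsingleton, Module.finrank_zero_of_subsingleton]))
  · intro α _ h A
    rw [Fintype.sum_option, ← h, ← wittClass_orthSum]
    refine wittClass_eq_of_isometric ⟨{
      LinearEquiv.piOptionEquivProd F (M := fun i => (A i).V) with map_app' := fun x => ?_ }⟩
    refine Eq.trans ?_ (QuadSpace.pi_form_apply A x).symm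
    rw [Fintype.sum_option]
    exact congrArg _ (QuadSpace.pi_form_apply (fun i => A (some i)) fun i => x (some i))

end WittClasses

/-! ### The classes of scaled binary forms -/

section ScaledForms

variable {F : Type u} [Field F] [CharP F 2]

/-- The form `d [1, a]` for a nonzero scalar `d`. -/
def scaledOnePfister (d : F) (hd : d ≠ 0) (a : F) : QuadSpace F where
  V := F × F
  form := d • binaryForm 1 a
  nonsingular := by
    refine nondegenerate_of_left _ fun x hx => (quadraticOnePfister a).nonsingular.1 x fun y => ?_
    have h := (QuadraticMap.polar_smul (binaryForm 1 a) d x y).symm.trans (hx y)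
    exact (smul_eq_zero.1 h).resolve_left hd
  even_finrank := by simp

open Classical in
/-- The Witt class of `d [1, a]`, extended by `0` to `d = 0`. -/
def scaledClass (d a : F) : WittGroup F :=
  if hd : d ≠ 0 then wittClass (scaledOnePfister d hd a) else 0

theorem scaledClass_of_ne_zero {d : F} (hd : d ≠ 0) (a : F) :
    scaledClass d a = wittClass (scaledOnePfister d hd a) := dif_pos hd

theorem scaledClass_zero_left (a : F) : scaledClass 0 a = 0 := dif_neg (by simp)

/-- The form `[1, p² + p]` is isotropic: it is `(u + p v) (u + (p + 1) v)`. -/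
theorem scaledClass_sq_add_self (d p : F) : scaledClass d (p ^ 2 + p) = 0 := by
  by_cases hd : d = 0
  · rw [hd, scaledClass_zero_left]
  have h2 : (2 : F) = 0 := CharTwo.two_eq_zero
  rw [scaledClass_of_ne_zero hd, ← wittClass_hyperbolicPlane]
  refine wittClass_eq_of_isometric (isometric_of_linearMap
    (LinearMap.prod (d • (LinearMap.fst F F F + p • LinearMap.snd F F F))
      (LinearMap.fst F F F + (p + 1) • LinearMap.snd F F F)) (fun (x : F × F) => ?_) rfl)
  change binaryForm 0 0 (d * (x.1 + p * x.2), x.1 + (p + 1) * x.2) = d * binaryForm _ _ x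
  simp only [binaryForm_apply]
  linear_combination d * p * x.1 * x.2 * h2

theorem scaledClass_zero_right (d : F) : scaledClass d 0 = 0 := by
  simpa using scaledClass_sq_add_self d 0

theorem scaledClass_add (d a b : F) :
    scaledClass d (a + b) = scaledClass d a + scaledClass d b := by
  by_cases hd : d = 0
  · simp [hd, scaledClass_zero_left]
  have h2 : (2 : F) = 0 := CharTwo.two_eq_zero
  rw [scaledClass_of_ne_zero hd, scaledClass_of_ne_zero hd, scaledClass_of_ne_zero hd,
    ← wittClass_orthSum, ← add_zero (wittClass _), ← wittClass_hyperbolicPlane, ← wittClass_orthSum]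
  let u : (F × F) × (F × F) →ₗ[F] F := LinearMap.fst F F F ∘ₗ LinearMap.fst F (F × F) (F × F)
  let v : (F × F) × (F × F) →ₗ[F] F := LinearMap.snd F F F ∘ₗ LinearMap.fst F (F × F) (F × F)
  let s : (F × F) × (F × F) →ₗ[F] F := LinearMap.fst F F F ∘ₗ LinearMap.snd F (F × F) (F × F)
  let t : (F × F) × (F × F) →ₗ[F] F := LinearMap.snd F F F ∘ₗ LinearMap.snd F (F × F) (F × F)
  -- With standard bases `e₁, f₁` and `e₂, f₂` of the two summands, `e₁` and `f₁ + f₂` span a copy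
  -- of `d [1, a + b]`, and `e₁ + e₂` and `d⁻¹ (f₂ + b (e₁ + e₂))` a hyperbolic plane orthogonal to it.
  refine wittClass_eq_of_isometric (isometric_of_linearMap
    (LinearMap.prod (LinearMap.prod (u + s + (d⁻¹ * b) • t) v)
      (LinearMap.prod (s + (d⁻¹ * b) • t) (v + d⁻¹ • t))) (fun x => ?_) rfl)
  obtain ⟨⟨u, v⟩, ⟨s, t⟩⟩ := x
  change d * binaryForm 1 a (u + s + d⁻¹ * b * t, v) +
    d * binaryForm 1 b (s + d⁻¹ * b * t, v + d⁻¹ * t) =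
      d * binaryForm 1 (a + b) (u, v) + binaryForm 0 0 (s, t)
  simp only [binaryForm_apply]
  have hd' : d * d⁻¹ = 1 := mul_inv_cancel₀ hd
  generalize d⁻¹ = c at hd'
  obtain rfl : d = c⁻¹ := eq_inv_of_mul_eq_one_left hd'
  have hc : c ≠ 0 := by rintro rfl; simp at hd'
  field_simp
  linear_combination (u * s + u * c * b * t + s ^ 2 + v * s + 2 * s * c * b * t +
    c ^ 2 * b ^ 2 * t ^ 2 + c * b * t * v + c * b * t * v + c ^ 2 * b * t ^ 2) * h2

theorem scaledClass_add_self (d a : F) : scaledClass d a + scaledClass d a = 0 := by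
  rw [← scaledClass_add, CharTwo.add_self_eq_zero, scaledClass_zero_right]

theorem scaledClass_sq_right (d p : F) : scaledClass d (p ^ 2) = scaledClass d p := by
  have h := scaledClass_sq_add_self d p
  rw [scaledClass_add] at h
  exact add_right_cancel (h.trans (scaledClass_add_self d p).symm)

theorem scaledClass_mul_sq (d a : F) {c : F} (hc : c ≠ 0) :
    scaledClass (d * c ^ 2) a = scaledClass d a := by
  by_cases hd : d = 0
  · simp [hd, scaledClass_zero_left]
  rw [scaledClass_of_ne_zero hd, scaledClass_of_ne_zero (mul_ne_zero hd (pow_ne_zero 2 hc))]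
  refine wittClass_eq_of_isometric (isometric_of_linearMap (c • LinearMap.id)
    (fun (x : F × F) => ?_) rfl)
  change d * binaryForm 1 a (c * x.1, c * x.2) = d * c ^ 2 * binaryForm 1 a x
  simp only [binaryForm_apply]
  ring

/-- The form `[1, p]` is the norm form of `F[θ]` with `θ² + θ = p`, and multiplication by `θ` is a
similarity with factor `p`. -/
theorem scaledClass_mul_self (d p : F) : scaledClass (d * p) p = scaledClass d p := by
  by_cases hp : p = 0
  · rw [hp, scaledClass_zero_right, scaledClass_zero_right]
  by_cases hd : d = 0
  · simp [hd]
  have h2 : (2 : F) = 0 := CharTwo.two_eq_zero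
  rw [scaledClass_of_ne_zero hd, scaledClass_of_ne_zero (mul_ne_zero hd hp)]
  refine wittClass_eq_of_isometric (isometric_of_linearMap
    (LinearMap.prod (p • LinearMap.snd F F F) (LinearMap.fst F F F + LinearMap.snd F F F))
    (fun (x : F × F) => ?_) rfl)
  change d * binaryForm 1 p (p * x.2, x.1 + x.2) = d * p * binaryForm 1 p x
  simp only [binaryForm_apply]
  linear_combination (d * p * x.1 * x.2 + d * p * x.2 ^ 2) * h2

theorem wittClass_quadraticPfister {m : ℕ} (β : Fin m → Fˣ) (a : F) :
    wittClass (quadraticPfister β a) = ∑ s, scaledClass (∏ j ∈ s, (β j : F)) a := by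
  have h0 : ∀ s : Finset (Fin m), ∏ j ∈ s, (β j : F) ≠ 0 := fun s =>
    Finset.prod_ne_zero_iff.2 fun j _ => (β j).ne_zero
  rw [Finset.sum_congr rfl fun s _ => scaledClass_of_ne_zero (h0 s) a, ← wittClass_pi]
  refine wittClass_eq_of_isometric (isometric_of_linearMap LinearMap.id (fun x => ?_) rfl)
  refine (QuadSpace.pi_form_apply
    (fun s => scaledOnePfister (∏ j ∈ s, (β j : F)) (h0 s) a) x).trans
      (Eq.trans ?_ (QuadSpace.pfisterTensor_form_apply β _ x).symm)
  simp only [pfisterEntry, Units.coe_prod]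
  rfl

/-! ### The symbol as an alternating map -/

theorem isPfister_symbol {m : ℕ} (a : Fin (m + 1) → F) : IsPfister (m + 1) (symbol a) := by
  unfold symbol
  split_ifs with h
  · exact ⟨m, rfl, _, _, QuadraticMap.Equivalent.refl _⟩
  · exact ⟨m, rfl, _, _, QuadraticMap.Equivalent.refl _⟩

theorem wittClass_symbol {m : ℕ} (a : Fin (m + 1) → F) :
    wittClass (symbol a) =
      ∑ s : Finset (Fin m), scaledClass (∏ j ∈ s, a j.castSucc) (∏ j, a j) := by
  unfold symbol
  split_ifs with h
  · exact wittClass_quadraticPfister _ _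
  · obtain ⟨j, hj⟩ := not_forall.1 h
    rw [wittClass_quadraticPfister, Finset.prod_eq_zero (Finset.mem_univ _) (not_not.1 hj)]
    simp [scaledClass_zero_right]

theorem wittClass_symbol_add_self {m : ℕ} (a : Fin (m + 1) → F) :
    wittClass (symbol a) + wittClass (symbol a) = 0 := by
  rw [wittClass_symbol, ← Finset.sum_add_distrib]
  exact Finset.sum_eq_zero fun s _ => scaledClass_add_self _ _

theorem wittClass_symbol_of_prod_eq_zero {m : ℕ} {a : Fin (m + 1) → F} (h : ∏ j, a j = 0) :
    wittClass (symbol a) = 0 := by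
  simp [wittClass_symbol, h, scaledClass_zero_right]

/-- Exchanging `aⱼ` with the last entry turns the summand of `⟨⟨a₁, …, aₘ⟩⟩ ⊗ [1, p]` at a set `s`
containing `j` into the one at `{j} ∪ sᶜ`, up to squares and the similarity factor `p = ∏ aᵢ`. -/
theorem wittClass_symbol_swap_last {m : ℕ} (a : Fin (m + 1) → F) (i : Fin (m + 1)) :
    wittClass (symbol (a ∘ Equiv.swap i (Fin.last m))) = wittClass (symbol a) := by
  have hprod : ∏ j, (a ∘ Equiv.swap i (Fin.last m)) j = ∏ j, a j :=
    Equiv.prod_comp (Equiv.swap i (Fin.last m)) a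
  induction i using Fin.lastCases with
  | last => simp
  | cast j =>
  by_cases h0 : ∏ j, a j = 0
  · rw [wittClass_symbol_of_prod_eq_zero h0, wittClass_symbol_of_prod_eq_zero (hprod.trans h0)]
  have hne : ∀ l, a l ≠ 0 := fun l => Finset.prod_ne_zero_iff.1 h0 l (Finset.mem_univ l)
  rw [wittClass_symbol, wittClass_symbol, hprod]
  let τ : Finset (Fin m) → Finset (Fin m) := fun s => if j ∈ s then insert j sᶜ else s
  have hτ : Function.Involutive τ := by
    intro s
    by_cases hj : j ∈ s
    · ext l
      by_cases hl : l = j <;> simp [τ, hj, hl]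
    · simp [τ, hj]
  rw [← Equiv.sum_comp (hτ.toPerm τ) fun s : Finset (Fin m) =>
    scaledClass (∏ j ∈ s, a j.castSucc) (∏ j, a j)]
  refine Finset.sum_congr rfl fun s _ => ?_
  change _ = scaledClass (∏ j ∈ τ s, a j.castSucc) (∏ j, a j)
  have hfix : ∀ l ∈ s.erase j, (a ∘ Equiv.swap j.castSucc (Fin.last m)) l.castSucc
      = a l.castSucc := fun l hl => by
    rw [Function.comp_apply, Equiv.swap_apply_of_ne_of_ne
      (fun h => Finset.ne_of_mem_erase hl (Fin.castSucc_injective m h)) (Fin.castSucc_ne_last l)]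
  by_cases hj : j ∈ s
  · have hτs : τ s = insert j sᶜ := if_pos hj
    rw [hτs, Finset.prod_insert (by simpa using hj), ← scaledClass_mul_self,
      ← Finset.mul_prod_erase _ _ hj, Finset.prod_congr rfl hfix]
    have h1 : ∏ l, a l = a j.castSucc * (∏ l ∈ s.erase j, a l.castSucc) *
        (∏ l ∈ sᶜ, a l.castSucc) * a (Fin.last m) := by
      rw [Fin.prod_univ_castSucc, ← Finset.prod_mul_prod_compl s,
        ← Finset.mul_prod_erase s _ hj]
    have h2 : (a ∘ Equiv.swap j.castSucc (Fin.last m)) j.castSucc = a (Fin.last m) := by simp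
    rw [h2, ← scaledClass_mul_sq (a j.castSucc * _) _ (mul_ne_zero (hne (Fin.last m))
      (Finset.prod_ne_zero_iff.2 fun l (_ : l ∈ s.erase j) => hne l.castSucc))]
    congr 1
    rw [h1]
    ring
  · have hτs : τ s = s := if_neg hj
    rw [Finset.erase_eq_of_notMem hj] at hfix
    rw [hτs, Finset.prod_congr rfl hfix]

theorem wittClass_symbol_update_last_add {m : ℕ} (a : Fin (m + 1) → F) (x y : F) :
    wittClass (symbol (Function.update a (Fin.last m) (x + y))) =
      wittClass (symbol (Function.update a (Fin.last m) x)) +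
        wittClass (symbol (Function.update a (Fin.last m) y)) := by
  simp only [wittClass_symbol, Fin.prod_univ_castSucc, Function.update_self, ne_eq,
    Fin.castSucc_ne_last, not_false_eq_true, Function.update_of_ne, mul_add, scaledClass_add,
    Finset.sum_add_distrib]

theorem wittClass_symbol_update_add {m : ℕ} (a : Fin (m + 1) → F) (i : Fin (m + 1)) (x y : F) :
    wittClass (symbol (Function.update a i (x + y))) =
      wittClass (symbol (Function.update a i x)) + wittClass (symbol (Function.update a i y)) := by
  have h : ∀ z, wittClass (symbol (Function.update a i z)) = wittClass (symbol
      (Function.update (a ∘ Equiv.swap i (Fin.last m)) (Fin.last m) z)) := fun z => by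
    rw [← wittClass_symbol_swap_last _ i, Function.update_comp_equiv]
    simp
  rw [h, h, h, wittClass_symbol_update_last_add]

/-- If `aᵢ` equals the last entry, the similarity factor `∏ aⱼ` of `[1, ∏ aⱼ]` is, up to a square,
the product of the entries other than these two. If there are such entries, multiplication by it
pairs off the summands, and the two members of a pair cancel. -/
theorem wittClass_symbol_eq_zero_of_eq_last {m : ℕ} (a : Fin (m + 1) → F) (i : Fin m)
    (h : a i.castSucc = a (Fin.last m)) : wittClass (symbol a) = 0 := by
  by_cases h0 : ∏ j, a j = 0
  · exact wittClass_symbol_of_prod_eq_zero h0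
  have hne : ∀ l, a l ≠ 0 := fun l => Finset.prod_ne_zero_iff.1 h0 l (Finset.mem_univ l)
  have hprod : ∏ l, a l = (∏ l ∈ ({i} : Finset (Fin m))ᶜ, a l.castSucc) * a (Fin.last m) ^ 2 := by
    rw [Fin.prod_univ_castSucc, ← Finset.prod_mul_prod_compl {i}, Finset.prod_singleton, h]
    ring
  rw [wittClass_symbol]
  rcases (({i} : Finset (Fin m))ᶜ).eq_empty_or_nonempty with hc | hc
  · -- Here `m = 1`, and the form is `⟨⟨a, a²]] = ⟨⟨a, a]]`, where `a` is a similarity factor of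
    -- `[1, a]`.
    rw [hc, Finset.prod_empty, one_mul] at hprod
    have huniv : (Finset.univ : Finset (Finset (Fin m))) = {∅, {i}} := by
      have hi : ∀ l : Fin m, l = i := fun l => by
        by_contra hl
        simpa [hc] using Finset.mem_compl.2 (fun h => hl (Finset.mem_singleton.1 h))
      ext s
      simp only [Finset.mem_univ, Finset.mem_insert, Finset.mem_singleton, true_iff]
      rcases s.eq_empty_or_nonempty with rfl | ⟨l, hl⟩
      · exact Or.inl rfl
      · right
        ext l'
        rw [hi l] at hl
        simp [hi l', hl]
    rw [huniv, Finset.sum_pair (Finset.singleton_ne_empty i).symm, hprod, scaledClass_sq_right,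
      scaledClass_sq_right, Finset.prod_empty, Finset.prod_singleton, h,
      ← scaledClass_mul_self 1, one_mul, scaledClass_add_self]
  · refine Finset.sum_involution (fun s _ => symmDiff s {i}ᶜ) (fun s _ => ?_) (fun s _ _ hs => ?_)
      (fun s _ => Finset.mem_univ _) (fun s _ => symmDiff_symmDiff_cancel_right _ _)
    · have key : (∏ l ∈ symmDiff s {i}ᶜ, a l.castSucc) * (∏ l ∈ s ∩ {i}ᶜ, a l.castSucc) ^ 2 =
          (∏ l ∈ s, a l.castSucc) * ∏ l ∈ ({i} : Finset (Fin m))ᶜ, a l.castSucc := by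
        have h1 : symmDiff s {i}ᶜ = (s \ {i}ᶜ) ∪ ({i}ᶜ \ s) := rfl
        rw [h1, Finset.prod_union disjoint_sdiff_sdiff,
          ← Finset.prod_inter_mul_prod_sdiff s {i}ᶜ, ← Finset.prod_inter_mul_prod_sdiff {i}ᶜ s,
          Finset.inter_comm _ s]
        ring
      have hs0 : ∏ l ∈ s ∩ {i}ᶜ, a l.castSucc ≠ 0 := Finset.prod_ne_zero_iff.2 fun l _ => hne _
      rw [← scaledClass_mul_sq (∏ l ∈ symmDiff s {i}ᶜ, a l.castSucc) _ hs0, key,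
        ← scaledClass_mul_sq (_ * ∏ l ∈ ({i} : Finset (Fin m))ᶜ, a l.castSucc) _
          (hne (Fin.last m)), mul_assoc, ← hprod, scaledClass_mul_self, scaledClass_add_self]
    · exact hc.ne_empty (symmDiff_eq_left.1 hs)

theorem wittClass_symbol_eq_zero_of_eq {m : ℕ} (a : Fin (m + 1) → F) (i j : Fin (m + 1))
    (h : a i = a j) (hij : i ≠ j) : wittClass (symbol a) = 0 := by
  induction j using Fin.lastCases with
  | last =>
    obtain ⟨i, rfl⟩ := Fin.exists_castSucc_eq.2 hij
    exact wittClass_symbol_eq_zero_of_eq_last a i h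
  | cast j =>
    rw [← wittClass_symbol_swap_last _ j.castSucc]
    induction i using Fin.lastCases with
    | last =>
      refine wittClass_symbol_eq_zero_of_eq_last _ j ?_
      simp [h]
    | cast i =>
      refine wittClass_symbol_eq_zero_of_eq_last _ i ?_
      simp [Equiv.swap_apply_of_ne_of_ne hij (Fin.castSucc_ne_last i), h]

/-- The Witt class of the symbol `((a₁, …, aₙ))` is additive in each entry and alternating. -/
def symbolClass (F : Type u) [Field F] [CharP F 2] (m : ℕ) :
    AlternatingMap ℤ F (WittGroup F) (Fin (m + 1)) where
  toFun a := wittClass (symbol a)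
  map_update_add' := by
    intro inst a i x y
    rw [Subsingleton.elim inst (instDecidableEqFin _)]
    exact wittClass_symbol_update_add a i x y
  map_update_smul' := by
    intro inst a i c x
    exact map_zsmul (AddMonoidHom.mk' (fun z => wittClass (symbol (Function.update a i z)))
      (by
        rw [Subsingleton.elim inst (instDecidableEqFin _)]
        exact wittClass_symbol_update_add a i)) c x
  map_eq_zero_of_eq' := wittClass_symbol_eq_zero_of_eq

end ScaledForms

end

/-! ### Sums of minors of an alternating map are decomposable -/

section Decomposable

variable {M N : Type*} [AddCommGroup M] [AddCommGroup N] {n : ℕ}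

/-- Adding an entry of an alternating map to other entries does not change the value. -/
theorem map_add_indicator_of_eq (g : AlternatingMap ℤ M N (Fin n)) (v : Fin n → M) (x : M)
    {i : Fin n} (hi : v i = x) (J : Finset (Fin n)) (hJ : i ∉ J) :
    g (fun j => v j + if j ∈ J then x else 0) = g v := by
  induction J using Finset.induction_on with
  | empty => simp
  | insert a J ha ih =>
    have hia : i ≠ a := fun h => hJ (h ▸ Finset.mem_insert_self _ _)
    have hiJ : i ∉ J := fun h => hJ (Finset.mem_insert_of_mem h)
    have h1 : (fun j => v j + if j ∈ insert a J then x else 0) =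
        Function.update (fun j => v j + if j ∈ J then x else 0) a (v a + x) := by
      ext j
      by_cases hj : j = a
      · subst hj; simp
      · simp [hj]
    have h2 : Function.update (fun j => v j + if j ∈ J then x else 0) a (v a) =
        fun j => v j + if j ∈ J then x else 0 := by
      ext j
      by_cases hj : j = a
      · subst hj; simp [ha]
      · simp [hj]
    rw [h1, g.map_update_add, h2, ih hiJ, add_eq_left]
    exact g.map_eq_zero_of_eq _ (by simp [hia, hi, hiJ]) hia

theorem map_add_indicator (g : AlternatingMap ℤ M N (Fin n)) (v : Fin n → M) (x : M)
    (J : Finset (Fin n)) :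
    g (fun j => v j + if j ∈ J then x else 0) = g v + ∑ j ∈ J, g (Function.update v j x) := by
  induction J using Finset.induction_on with
  | empty => simp
  | insert a J ha ih =>
    have h1 : (fun j => v j + if j ∈ insert a J then x else 0) =
        Function.update (fun j => v j + if j ∈ J then x else 0) a (v a + x) := by
      ext j
      by_cases hj : j = a
      · subst hj; simp
      · simp [hj]
    have h2 : Function.update (fun j => v j + if j ∈ J then x else 0) a (v a) =
        fun j => v j + if j ∈ J then x else 0 := by
      ext j
      by_cases hj : j = a
      · subst hj; simp [ha]
      · simp [hj]
    have h3 : Function.update (fun j => v j + if j ∈ J then x else 0) a x =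
        fun j => Function.update v a x j + if j ∈ J then x else 0 := by
      ext j
      by_cases hj : j = a
      · subst hj; simp [ha]
      · simp [hj]
    rw [h1, g.map_update_add, h2, ih, h3,
      map_add_indicator_of_eq g _ x (Function.update_self a x v) J ha, Finset.sum_insert ha]
    abel

/-- A permutation of the entries changes the value at most by a sign, which is invisible if all
values are killed by two. -/
theorem map_comp_eq_of_range_subset (g : AlternatingMap ℤ M N (Fin n))
    (h2 : ∀ v, g v + g v = 0) {ι : Type*} (v : ι → M) {f f' : Fin n → ι}
    (hf : Function.Injective f) (h : ∀ j, ∃ j', f' j' = f j) : g (v ∘ f) = g (v ∘ f') := by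
  choose σ hσ using h
  have hσi : Function.Injective σ := fun a b hab => hf (by rw [← hσ, ← hσ, hab])
  let e : Equiv.Perm (Fin n) := Equiv.ofBijective σ (Finite.injective_iff_bijective.1 hσi)
  have : v ∘ f = (v ∘ f') ∘ e := funext fun j => congrArg v (hσ j).symm
  rw [this, g.map_perm]
  rcases Int.units_eq_one_or (Equiv.Perm.sign e) with h | h
  · rw [h, one_smul]
  · rw [h, Units.neg_smul, one_smul]
    exact neg_eq_of_add_eq_zero_left (h2 _)

/-- In exterior algebra terms: an `n`-vector in a space spanned by `n + 1` vectors is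
decomposable. -/
theorem exists_eq_sum_succAbove (g : AlternatingMap ℤ M N (Fin n)) (hn : n ≠ 0)
    (h2 : ∀ v, g v + g v = 0) (v : Fin (n + 1) → M) (I : Finset (Fin (n + 1))) :
    ∃ b, g b = ∑ i ∈ I, g (v ∘ i.succAbove) := by
  rcases I.eq_empty_or_nonempty with rfl | ⟨i₀, hi₀⟩
  · exact ⟨0, by rw [Finset.sum_empty]; exact g.map_coord_zero (⟨0, Nat.pos_of_ne_zero hn⟩) rfl⟩
  let J : Finset (Fin n) := Finset.univ.filter fun j => i₀.succAbove j ∈ I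
  refine ⟨_, (map_add_indicator g (v ∘ i₀.succAbove) (v i₀) J).trans ?_⟩
  have hI : I = insert i₀ (J.map i₀.succAboveEmb) := by
    ext i
    by_cases hi : i = i₀
    · simp [hi, hi₀]
    · obtain ⟨j, rfl⟩ := Fin.exists_succAbove_eq hi
      simp [J]
  rw [hI, Finset.sum_insert (by simp [Fin.succAbove_ne]), Finset.sum_map]
  refine congrArg _ (Finset.sum_congr rfl fun j _ => ?_)
  have h1 : Function.update (v ∘ i₀.succAbove) j (v i₀) =
      v ∘ Function.update i₀.succAbove j i₀ := by
    rw [Function.comp_update]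
  rw [h1]
  have hne : ∀ l, Function.update i₀.succAbove j i₀ l ≠ i₀.succAbove j := by
    intro l
    by_cases hl : l = j
    · subst hl; simp
    · simp [hl]
  refine map_comp_eq_of_range_subset g h2 v ?_ fun l => ?_
  · intro a b hab
    by_cases ha : a = j <;> by_cases hb : b = j
    · rw [ha, hb]
    · subst ha
      simp only [Function.update_self, Function.update_of_ne hb] at hab
      exact absurd hab.symm (Fin.succAbove_ne _ _)
    · subst hb
      simp only [Function.update_self, Function.update_of_ne ha] at hab
      exact absurd hab (Fin.succAbove_ne _ _)
    · simp only [Function.update_of_ne ha, Function.update_of_ne hb] at hab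
      exact Fin.succAbove_right_injective hab
  · exact Fin.exists_succAbove_eq (hne l)

end Decomposable

/-- In a subgroup generated by finitely many elements of order two, every element is the sum of a
subfamily of the generators. -/
theorem exists_eq_sum_of_mem_closure {ι N : Type*} [DecidableEq ι] [AddCommGroup N] (f : ι → N)
    (h2 : ∀ i, f i + f i = 0) {x : N} (hx : x ∈ AddSubgroup.closure (Set.range f)) :
    ∃ I : Finset ι, x = ∑ i ∈ I, f i := by
  have hneg : ∀ I : Finset ι, -∑ i ∈ I, f i = ∑ i ∈ I, f i := fun I => by
    rw [neg_eq_iff_add_eq_zero, ← Finset.sum_add_distrib]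
    exact Finset.sum_eq_zero fun i _ => h2 i
  induction hx using AddSubgroup.closure_induction with
  | mem x hx =>
    obtain ⟨i, rfl⟩ := hx
    exact ⟨{i}, by simp⟩
  | zero => exact ⟨∅, by simp⟩
  | add x y _ _ hx hy =>
    obtain ⟨I, rfl⟩ := hx
    obtain ⟨J, rfl⟩ := hy
    refine ⟨symmDiff I J, ?_⟩
    have h1 : symmDiff I J = (I \ J) ∪ (J \ I) := rfl
    rw [h1, Finset.sum_union disjoint_sdiff_sdiff, ← Finset.sum_inter_add_sum_sdiff I J,
      ← Finset.sum_inter_add_sum_sdiff J I, Finset.inter_comm J I]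
    have h3 := neg_eq_iff_add_eq_zero.1 (hneg (I ∩ J))
    rw [add_add_add_comm, h3, zero_add]
  | neg x _ hx =>
    obtain ⟨I, rfl⟩ := hx
    exact ⟨I, hneg I⟩

theorem isStronglyTight_range_symbol_succAbove {F : Type u} [Field F] [CharP F 2] {m : ℕ}
    (v : Fin (m + 2) → F) :
    IsStronglyTight (m + 1) (Set.range fun i : Fin (m + 2) => symbol (v ∘ i.succAbove)) := by
  refine ⟨?_, fun w hw => ?_⟩
  · rintro _ ⟨i, rfl⟩
    exact isPfister_symbol _
  rw [← Set.range_comp] at hw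
  obtain ⟨I, rfl⟩ := exists_eq_sum_of_mem_closure _ (fun _ => wittClass_symbol_add_self _) hw
  obtain ⟨b, hb⟩ := exists_eq_sum_succAbove (symbolClass F m) m.succ_ne_zero
    wittClass_symbol_add_self v I
  exact ⟨symbol b, isPfister_symbol b, hb⟩

/-! ### Leading terms of the values -/

section LeadingTerms

open MvPolynomial

variable {σ k S : Type*} [Field k] (ord : MonomialOrder σ)

theorem degree_monomial_mul_sq (e : σ →₀ ℕ) {g : MvPolynomial σ k} (hg : g ≠ 0) :
    ord.degree (monomial e 1 * g ^ 2) = e + 2 • ord.degree g := by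
  classical
  rw [ord.degree_mul (by simp) (pow_ne_zero 2 hg), ord.degree_monomial, ord.degree_pow]
  simp

theorem leadingCoeff_monomial_mul_sq (e : σ →₀ ℕ) (g : MvPolynomial σ k) :
    ord.leadingCoeff (monomial e 1 * g ^ 2) = ord.leadingCoeff g ^ 2 := by
  rw [ord.leadingCoeff_mul, ord.leadingCoeff_pow, ord.leadingCoeff_monomial, one_mul]

theorem degree_monomial_mul_mul (e : σ →₀ ℕ) {g h : MvPolynomial σ k} (hg : g ≠ 0) (hh : h ≠ 0) :
    ord.degree (monomial e 1 * (g * h)) = e + (ord.degree g + ord.degree h) := by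
  classical
  rw [ord.degree_mul (by simp) (mul_ne_zero hg hh), ord.degree_monomial, ord.degree_mul hg hh]
  simp

theorem toSyn_add_lt_of_le {e π a b c d : σ →₀ ℕ} (hπ : π ≠ 0)
    (ha : ord.toSyn (e + 2 • a) ≤ ord.toSyn c) (hb : ord.toSyn (e + π + 2 • b) ≤ ord.toSyn d) :
    ord.toSyn (2 • (e + (a + b))) < ord.toSyn (c + d) := by
  have h3 : 0 < ord.toSyn π := ord.toSyn_lt_iff_ne_zero.2 (by simpa using hπ)
  have h4 : ord.toSyn (e + 2 • a + (e + π + 2 • b)) ≤ ord.toSyn (c + d) := by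
    rw [map_add, map_add _ c]
    exact add_le_add ha hb
  refine lt_of_lt_of_le ?_ h4
  have h5 : e + 2 • a + (e + π + 2 • b) = 2 • (e + (a + b)) + π := by
    simp only [two_nsmul]
    abel
  rw [h5, map_add]
  exact lt_add_of_pos_right _ h3

theorem toSyn_lt_of_two_nsmul_lt {a b : σ →₀ ℕ}
    (h : ord.toSyn (2 • a) < ord.toSyn (2 • b)) : ord.toSyn a < ord.toSyn b := by
  rw [map_nsmul, map_nsmul] at h
  exact lt_of_nsmul_lt_nsmul_right 2 h

/-- The exponents of the diagonal entries of `⊥ₛ x^{e s} [1, x^π]`. -/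
noncomputable def entryExponent (e : S → σ →₀ ℕ) (π : σ →₀ ℕ) (t : S × Bool) : σ →₀ ℕ :=
  e t.1 + if t.2 then π else 0

/-- The value of `⊥ₛ x^{e s} [1, x^π]` at a vector of polynomials; the coordinates at `(s, false)`
and `(s, true)` are those of the summand with index `s`. -/
noncomputable def polyForm [Fintype S] (e : S → σ →₀ ℕ) (π : σ →₀ ℕ)
    (G : S × Bool → MvPolynomial σ k) : MvPolynomial σ k :=
  ∑ s, monomial (e s) 1 * (G (s, false) ^ 2 + G (s, false) * G (s, true) +
    monomial π 1 * G (s, true) ^ 2)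

/-- The value of the polar form of `polyForm` at two vectors of polynomials. -/
noncomputable def polyPolar [Fintype S] (e : S → σ →₀ ℕ)
    (G H : S × Bool → MvPolynomial σ k) : MvPolynomial σ k :=
  ∑ s, monomial (e s) 1 * (G (s, false) * H (s, true) + G (s, true) * H (s, false))

theorem polyForm_eq_diagonal_add [Fintype S] (e : S → σ →₀ ℕ) (π : σ →₀ ℕ)
    (G : S × Bool → MvPolynomial σ k) :
    polyForm e π G = ∑ t, monomial (entryExponent e π t) 1 * G t ^ 2 +
      ∑ s, monomial (e s) 1 * (G (s, false) * G (s, true)) := by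
  rw [polyForm, Fintype.sum_prod_type, ← Finset.sum_add_distrib]
  refine Finset.sum_congr rfl fun s _ => ?_
  have h : monomial (e s + π) (1 : k) = monomial (e s) 1 * monomial π 1 := by
    rw [monomial_mul, one_mul]
  rw [Fintype.sum_bool]
  simp only [entryExponent, if_true, Bool.false_eq_true, if_false, add_zero, h]
  ring

variable [Fintype S] {e : S → σ →₀ ℕ} {π : σ →₀ ℕ}

/-- If the diagonal entries have distinct exponents modulo `2`, exactly one diagonal term of a value
has maximal degree, and the mixed terms have smaller degree because `π ≠ 0`: twice the exponent of
`x^{e s} u v` is the sum of those of `x^{e s} u²` and `x^{e s + π} v²`, minus `π`. -/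
theorem exists_leading_entry
    (hE : ∀ t t', (∀ i, entryExponent e π t i ≡ entryExponent e π t' i [MOD 2]) → t = t')
    (hπ : π ≠ 0) {G : S × Bool → MvPolynomial σ k} (hG : G ≠ 0) :
    ∃ t, polyForm e π G ≠ 0 ∧
      ord.degree (polyForm e π G) = entryExponent e π t + 2 • ord.degree (G t) ∧
      ord.leadingCoeff (polyForm e π G) = ord.leadingCoeff (G t) ^ 2 ∧
      ∀ t', G t' ≠ 0 → ord.toSyn (entryExponent e π t' + 2 • ord.degree (G t')) ≤
        ord.toSyn (ord.degree (polyForm e π G)) := by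
  classical
  have hne : (Finset.univ.filter fun t => G t ≠ 0).Nonempty := by
    obtain ⟨t, ht⟩ := Function.ne_iff.1 hG
    exact ⟨t, by simpa using ht⟩
  obtain ⟨t, ht, hmax⟩ := Finset.exists_max_image _
    (fun t => ord.toSyn (entryExponent e π t + 2 • ord.degree (G t))) hne
  simp only [Finset.mem_filter, Finset.mem_univ, true_and] at ht hmax
  set D := entryExponent e π t + 2 • ord.degree (G t) with hD
  have hdiag : ∀ t', t' ≠ t → ∀ d, ord.toSyn D ≤ ord.toSyn d →
      coeff d (monomial (entryExponent e π t') 1 * G t' ^ 2) = 0 := by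
    intro t' ht' d hd
    by_cases h0 : G t' = 0
    · simp [h0]
    refine ord.coeff_eq_zero_of_lt (lt_of_lt_of_le (lt_of_le_of_ne ?_ fun h => ht' ?_) hd)
    · rw [degree_monomial_mul_sq ord _ h0]
      exact hmax t' h0
    · rw [degree_monomial_mul_sq ord _ h0] at h
      refine hE _ _ fun i => ?_
      have h1 := DFunLike.congr_fun (ord.toSyn.injective h) i
      simp only [hD, Finsupp.add_apply, Finsupp.smul_apply, smul_eq_mul] at h1
      rw [Nat.ModEq]
      omega
  have hmixed : ∀ s, ∀ d, ord.toSyn D ≤ ord.toSyn d →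
      coeff d (monomial (e s) 1 * (G (s, false) * G (s, true))) = 0 := by
    intro s d hd
    by_cases h0 : G (s, false) = 0
    · simp [h0]
    by_cases h1 : G (s, true) = 0
    · simp [h1]
    refine ord.coeff_eq_zero_of_lt (lt_of_lt_of_le ?_ hd)
    rw [degree_monomial_mul_mul ord _ h0 h1]
    have h2 := toSyn_add_lt_of_le ord (e := e s) hπ
      (by simpa [entryExponent] using hmax _ h0) (by simpa [entryExponent] using hmax _ h1)
    rw [← two_nsmul] at h2
    exact toSyn_lt_of_two_nsmul_lt ord h2
  have hcoeff : ∀ d, ord.toSyn D ≤ ord.toSyn d → coeff d (polyForm e π G) =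
      coeff d (monomial (entryExponent e π t) 1 * G t ^ 2) := by
    intro d hd
    rw [polyForm_eq_diagonal_add, coeff_add, coeff_sum, coeff_sum,
      Finset.sum_eq_zero fun s _ => hmixed s d hd, add_zero]
    exact Finset.sum_eq_single t (fun t' _ h => hdiag t' h d hd) (by simp)
  have hlead : coeff D (polyForm e π G) = ord.leadingCoeff (G t) ^ 2 := by
    rw [hcoeff D le_rfl, ← leadingCoeff_monomial_mul_sq ord (entryExponent e π t),
      MonomialOrder.leadingCoeff, degree_monomial_mul_sq ord _ ht]
  have hlead0 : coeff D (polyForm e π G) ≠ 0 := by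
    rw [hlead]
    exact pow_ne_zero 2 (ord.leadingCoeff_ne_zero_iff.2 ht)
  have hdeg : ord.degree (polyForm e π G) = D := by
    refine ord.toSyn.injective (le_antisymm ?_ (ord.le_degree (mem_support_iff.2 hlead0)))
    refine ord.degree_le_iff.2 fun d hd => ?_
    by_contra hlt
    rw [not_le] at hlt
    refine mem_support_iff.1 hd ?_
    rw [hcoeff d hlt.le]
    refine ord.coeff_eq_zero_of_lt ?_
    rwa [degree_monomial_mul_sq ord _ ht]
  refine ⟨t, fun h => hlead0 (by simp [h]), hdeg, ?_, fun t' ht' => ?_⟩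
  · rw [MonomialOrder.leadingCoeff, hdeg, hlead]
  · rw [hdeg]
    exact hmax t' ht'

/-- In valuation-theoretic terms, the polar form is small compared to the values of the form. -/
theorem degree_polyPolar_lt
    (hE : ∀ t t', (∀ i, entryExponent e π t i ≡ entryExponent e π t' i [MOD 2]) → t = t')
    (hπ : π ≠ 0) {G H : S × Bool → MvPolynomial σ k} (h : polyPolar e G H ≠ 0) :
    ord.toSyn (2 • ord.degree (polyPolar e G H)) <
      ord.toSyn (ord.degree (polyForm e π G) + ord.degree (polyForm e π H)) := by
  have hG : G ≠ 0 := by rintro rfl; simp [polyPolar] at h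
  have hH : H ≠ 0 := by rintro rfl; simp [polyPolar] at h
  obtain ⟨-, -, -, -, hGle⟩ := exists_leading_entry ord hE hπ hG
  obtain ⟨-, -, -, -, hHle⟩ := exists_leading_entry ord hE hπ hH
  have hsum : ∑ s, coeff (ord.degree (polyPolar e G H)) (monomial (e s) 1 *
      (G (s, false) * H (s, true) + G (s, true) * H (s, false))) ≠ 0 := by
    rw [← coeff_sum]
    exact ord.leadingCoeff_ne_zero_iff.2 h
  obtain ⟨s, -, hs⟩ := Finset.exists_ne_zero_of_sum_ne_zero hsum
  rw [mul_add, coeff_add] at hs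
  have key : ∀ {a b : MvPolynomial σ k},
      coeff (ord.degree (polyPolar e G H)) (monomial (e s) 1 * (a * b)) ≠ 0 →
      a ≠ 0 ∧ b ≠ 0 ∧ ord.toSyn (ord.degree (polyPolar e G H)) ≤
        ord.toSyn (e s + (ord.degree a + ord.degree b)) := by
    intro a b hab
    have ha : a ≠ 0 := by rintro rfl; simp at hab
    have hb : b ≠ 0 := by rintro rfl; simp at hab
    refine ⟨ha, hb, ?_⟩
    rw [← degree_monomial_mul_mul ord _ ha hb]
    exact ord.le_degree (mem_support_iff.2 hab)
  have hdouble : ∀ {d d' : σ →₀ ℕ}, ord.toSyn d ≤ ord.toSyn d' →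
      ord.toSyn (2 • d) ≤ ord.toSyn (2 • d') := fun h => by
    rw [map_nsmul, map_nsmul]
    exact nsmul_le_nsmul_right h 2
  by_cases h1 : coeff (ord.degree (polyPolar e G H))
      (monomial (e s) 1 * (G (s, false) * H (s, true))) = 0
  · rw [h1, zero_add] at hs
    obtain ⟨ha, hb, hle⟩ := key hs
    rw [add_comm (ord.degree (G _))] at hle
    rw [add_comm (ord.degree (polyForm e π G))]
    exact lt_of_le_of_lt (hdouble hle) (toSyn_add_lt_of_le ord hπ
      (by simpa [entryExponent] using hHle _ hb) (by simpa [entryExponent] using hGle _ ha))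
  · obtain ⟨ha, hb, hle⟩ := key h1
    exact lt_of_le_of_lt (hdouble hle) (toSyn_add_lt_of_le ord hπ
      (by simpa [entryExponent] using hGle _ ha) (by simpa [entryExponent] using hHle _ hb))

/-- If `p + u r + u²` always has a square leading term, of degree greater than that of `r²`, then
its degree can be lowered indefinitely by absorbing the leading term into `u`. -/
theorem no_descent [CharP k 2] (p r : MvPolynomial σ k)
    (h0 : ∀ u, p + u * r + u ^ 2 ≠ 0)
    (hdeg : ∀ u, ∃ δ, ord.degree (p + u * r + u ^ 2) = 2 • δ)
    (hlead : ∀ u, IsSquare (ord.leadingCoeff (p + u * r + u ^ 2)))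
    (hr : r ≠ 0 → ∀ u, ord.toSyn (2 • ord.degree r) <
      ord.toSyn (ord.degree (p + u * r + u ^ 2))) : False := by
  classical
  let f : MvPolynomial σ k → MvPolynomial σ k := fun u => p + u * r + u ^ 2
  obtain ⟨-, ⟨u, rfl⟩, hmin⟩ := (wellFounded_lt (α := ord.syn)).has_min
    (Set.range fun u => ord.toSyn (ord.degree (f u))) ⟨_, 0, rfl⟩
  obtain ⟨δ, hδ⟩ := hdeg u
  obtain ⟨c, hc⟩ := hlead u
  have h2 : (2 : MvPolynomial σ k) = 0 := CharTwo.two_eq_zero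
  have hstep : f (u + monomial δ c) = f u + monomial δ c * r + monomial (2 • δ) (c * c) := by
    have h3 : monomial (2 • δ) (c * c) = (monomial δ c) ^ 2 := by
      rw [monomial_pow, sq]
    rw [h3]
    linear_combination u * monomial δ c * h2
  refine hmin _ ⟨u + monomial δ c, rfl⟩ ?_
  change ord.toSyn (ord.degree (f (u + monomial δ c))) < ord.toSyn (ord.degree (f u))
  by_contra hle
  rw [not_lt] at hle
  refine ord.leadingCoeff_ne_zero_iff.2 (h0 (u + monomial δ c)) ?_
  change coeff (ord.degree (f (u + monomial δ c))) (f (u + monomial δ c)) = 0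
  generalize ord.degree (f (u + monomial δ c)) = d at hle
  have hmid : coeff d (monomial δ c * r) = 0 := by
    by_cases hr0 : r = 0
    · simp [hr0]
    refine ord.coeff_eq_zero_of_lt (lt_of_lt_of_le (lt_of_le_of_lt ord.degree_mul_le ?_) hle)
    have h4 := hr hr0 u
    rw [hδ] at h4
    change _ < ord.toSyn (ord.degree (p + u * r + u ^ 2))
    rw [hδ, two_nsmul, map_add, map_add]
    exact add_lt_add_of_le_of_lt (ord.degree_monomial_le c) (toSyn_lt_of_two_nsmul_lt ord h4)
  rw [hstep, coeff_add, coeff_add, hmid, add_zero, coeff_monomial]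
  change ord.toSyn (ord.degree (p + u * r + u ^ 2)) ≤ _ at hle
  rw [hδ] at hle
  split_ifs with hd
  · subst hd
    rw [← hc, MonomialOrder.leadingCoeff, hδ]
    exact CharTwo.add_self_eq_zero _
  · rw [add_zero]
    refine ord.coeff_eq_zero_of_lt (lt_of_le_of_ne ?_ fun h => hd ?_)
    · change ord.toSyn (ord.degree (p + u * r + u ^ 2)) ≤ _
      rwa [hδ]
    · change ord.toSyn (ord.degree (p + u * r + u ^ 2)) = _ at h
      rw [hδ] at h
      exact ord.toSyn.injective h

end LeadingTerms

/-! ### Values of Pfister forms in the variables -/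

section VariableForms

open MvPolynomial

variable {k : Type u} [Field k] {n m : ℕ}

theorem ratVar_ne_zero (k : Type u) [Field k] (n : ℕ) (i : Fin (n + 1)) : ratVar k n i ≠ 0 :=
  (map_ne_zero_iff _ (IsFractionRing.injective _ _)).2 (X_ne_zero i)

/-- The exponent of the product of the first `m` variables over a subset. -/
noncomputable def subsetExponent (a : Fin (m + 1) → Fin (n + 1)) (s : Finset (Fin m)) :
    Fin (n + 1) →₀ ℕ :=
  ∑ j ∈ s, Finsupp.single (a j.castSucc) 1

/-- The exponent of the product of all the variables. -/
noncomputable def fullExponent (a : Fin (m + 1) → Fin (n + 1)) : Fin (n + 1) →₀ ℕ :=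
  ∑ j, Finsupp.single (a j) 1

theorem algebraMap_monomial_subsetExponent (a : Fin (m + 1) → Fin (n + 1)) (s : Finset (Fin m)) :
    algebraMap (MvPolynomial (Fin (n + 1)) k) (RatFunField k n)
      (monomial (subsetExponent a s) 1) = ∏ j ∈ s, ratVar k n (a j.castSucc) := by
  rw [subsetExponent, monomial_sum_one, map_prod]
  rfl

theorem algebraMap_monomial_fullExponent (a : Fin (m + 1) → Fin (n + 1)) :
    algebraMap (MvPolynomial (Fin (n + 1)) k) (RatFunField k n)
      (monomial (fullExponent a) 1) = ∏ j, ratVar k n (a j) := by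
  rw [fullExponent, monomial_sum_one, map_prod]
  rfl

theorem fullExponent_apply {a : Fin (m + 1) → Fin (n + 1)} (ha : Function.Injective a)
    (l : Fin (m + 1)) : fullExponent a (a l) = 1 := by
  simp [fullExponent, Finsupp.finsetSum_apply, Finsupp.single_apply, ha.eq_iff]

theorem subsetExponent_apply_castSucc {a : Fin (m + 1) → Fin (n + 1)} (ha : Function.Injective a)
    (s : Finset (Fin m)) (l : Fin m) :
    subsetExponent a s (a l.castSucc) = if l ∈ s then 1 else 0 := by
  simp [subsetExponent, Finsupp.finsetSum_apply, Finsupp.single_apply, ha.eq_iff]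

theorem subsetExponent_apply_last {a : Fin (m + 1) → Fin (n + 1)} (ha : Function.Injective a)
    (s : Finset (Fin m)) : subsetExponent a s (a (Fin.last m)) = 0 := by
  simp [subsetExponent, Finsupp.finsetSum_apply, ha.eq_iff,
    Fin.castSucc_ne_last]

theorem entryExponent_apply_of_notMem_range {a : Fin (m + 1) → Fin (n + 1)} {i : Fin (n + 1)}
    (hi : i ∉ Set.range a) (t : Finset (Fin m) × Bool) :
    entryExponent (subsetExponent a) (fullExponent a) t i = 0 := by
  have h : ∀ j, a j ≠ i := fun j hj => hi ⟨j, hj⟩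
  have h1 : fullExponent a i = 0 := by
    simp [fullExponent, Finsupp.finsetSum_apply, h]
  have h2 : subsetExponent a t.1 i = 0 := by
    simp [subsetExponent, Finsupp.finsetSum_apply, h]
  unfold entryExponent
  split_ifs <;> simp [h1, h2]

theorem fullExponent_ne_zero {a : Fin (m + 1) → Fin (n + 1)} (ha : Function.Injective a) :
    fullExponent a ≠ 0 := fun h => by
  have h1 := fullExponent_apply ha 0
  rw [h] at h1
  exact zero_ne_one h1

/-- The last variable divides the second half of the diagonal entries only, and distinguishes the
two halves; the other variables then distinguish the subsets. -/
theorem eq_of_entryExponent_modEq {a : Fin (m + 1) → Fin (n + 1)} (ha : Function.Injective a)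
    (t t' : Finset (Fin m) × Bool)
    (h : ∀ i, entryExponent (subsetExponent a) (fullExponent a) t i ≡
      entryExponent (subsetExponent a) (fullExponent a) t' i [MOD 2]) : t = t' := by
  obtain ⟨s, b⟩ := t
  obtain ⟨s', b'⟩ := t'
  have hb : b = b' := by
    have h1 := h (a (Fin.last m))
    simp only [entryExponent, Finsupp.add_apply, subsetExponent_apply_last ha] at h1
    cases b <;> cases b' <;> simp [fullExponent_apply ha, Nat.ModEq] at h1 ⊢
  subst hb
  refine Prod.ext (Finset.ext fun l => ?_) rfl
  have h1 := h (a l.castSucc)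
  simp only [entryExponent, Finsupp.add_apply, subsetExponent_apply_castSucc ha] at h1
  have h2 := Nat.ModEq.add_right_cancel' _ h1
  by_cases hl : l ∈ s <;> by_cases hl' : l ∈ s' <;> simp [hl, hl', Nat.ModEq] at h2 ⊢

theorem exists_clear_denominators (x : Finset (Fin m) → RatFunField k n × RatFunField k n) :
    ∃ (D : MvPolynomial (Fin (n + 1)) k)
      (G : Finset (Fin m) × Bool → MvPolynomial (Fin (n + 1)) k),
      D ≠ 0 ∧ ∀ s, algebraMap _ (RatFunField k n) (G (s, false)) = algebraMap _ _ D * (x s).1 ∧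
        algebraMap _ (RatFunField k n) (G (s, true)) = algebraMap _ _ D * (x s).2 := by
  obtain ⟨b, hb⟩ := IsLocalization.exist_integer_multiples_of_finite
    (nonZeroDivisors (MvPolynomial (Fin (n + 1)) k))
    (fun t : Finset (Fin m) × Bool => if t.2 then (x t.1).2 else (x t.1).1)
  choose G hG using hb
  refine ⟨b, G, nonZeroDivisors.ne_zero b.2, fun s => ⟨?_, ?_⟩⟩
  · simpa [Algebra.smul_def] using hG (s, false)
  · simpa [Algebra.smul_def] using hG (s, true)

theorem exists_eq_div_sq (c : RatFunField k n) : ∃ p q : MvPolynomial (Fin (n + 1)) k, q ≠ 0 ∧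
    c * algebraMap _ _ q ^ 2 = algebraMap _ (RatFunField k n) p := by
  obtain ⟨p, q, hq, rfl⟩ := IsFractionRing.div_surjective (A := MvPolynomial (Fin (n + 1)) k) c
  have hq0 := nonZeroDivisors.ne_zero hq
  have hq1 : algebraMap (MvPolynomial (Fin (n + 1)) k) (RatFunField k n) q ≠ 0 :=
    (map_ne_zero_iff _ (IsFractionRing.injective _ _)).2 hq0
  refine ⟨p * q, q, hq0, ?_⟩
  rw [map_mul]
  field_simp

variable [CharP k 2]

/-- The symbol `((x₁, …, xₘ₊₁))` of the variables `xⱼ = α_{a j}`. -/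
noncomputable def variablePfister (k : Type u) [Field k] [CharP k 2] {n m : ℕ}
    (a : Fin (m + 1) → Fin (n + 1)) : QuadSpace (RatFunField k n) :=
  quadraticPfister (fun j : Fin m => Units.mk0 _ (ratVar_ne_zero k n (a j.castSucc)))
    (∏ j, ratVar k n (a j))

theorem symbol_ratVar (a : Fin (m + 1) → Fin (n + 1)) :
    symbol (fun j => ratVar k n (a j)) = variablePfister k a :=
  dif_pos fun _ => ratVar_ne_zero k n _

theorem omitForm_eq_variablePfister (i : Fin (m + 2)) :
    omitForm k (m + 1) i = variablePfister k i.succAbove :=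
  symbol_ratVar _

theorem variablePfister_form_apply (a : Fin (m + 1) → Fin (n + 1))
    (x : Finset (Fin m) → RatFunField k n × RatFunField k n) :
    (variablePfister k a).form x = ∑ s, (∏ j ∈ s, ratVar k n (a j.castSucc)) *
      ((x s).1 ^ 2 + (x s).1 * (x s).2 + (∏ j, ratVar k n (a j)) * (x s).2 ^ 2) := by
  refine (QuadSpace.pfisterTensor_form_apply
    (fun j : Fin m => Units.mk0 _ (ratVar_ne_zero k n (a j.castSucc))) (quadraticOnePfister _) x).trans
      (Finset.sum_congr rfl fun s _ => ?_)
  rw [pfisterEntry, Units.coe_prod]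
  refine congrArg _ ((binaryForm_apply _ _ (x s)).trans ?_)
  rw [one_mul]

theorem variablePfister_polar_apply (a : Fin (m + 1) → Fin (n + 1))
    (x y : Finset (Fin m) → RatFunField k n × RatFunField k n) :
    QuadraticMap.polar (variablePfister k a).form x y =
      ∑ s, (∏ j ∈ s, ratVar k n (a j.castSucc)) * ((x s).1 * (y s).2 + (x s).2 * (y s).1) := by
  have h2 : (2 : RatFunField k n) = 0 := CharTwo.two_eq_zero
  have hxy : (variablePfister k a).form (x + y) = _ := variablePfister_form_apply a (x + y)
  refine (congrArg₂ (· - ·) (congrArg₂ (· - ·) hxy (variablePfister_form_apply a x))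
    (variablePfister_form_apply a y)).trans ?_
  rw [← Finset.sum_sub_distrib, ← Finset.sum_sub_distrib]
  refine Finset.sum_congr rfl fun s _ => ?_
  simp only [Pi.add_apply, Prod.fst_add, Prod.snd_add]
  linear_combination (∏ j ∈ s, ratVar k n (a j.castSucc)) *
    ((x s).1 * (y s).1 + (∏ j, ratVar k n (a j)) * (x s).2 * (y s).2) * h2

theorem algebraMap_polyForm (a : Fin (m + 1) → Fin (n + 1))
    {x : Finset (Fin m) → RatFunField k n × RatFunField k n} {D : MvPolynomial (Fin (n + 1)) k}
    {G : Finset (Fin m) × Bool → MvPolynomial (Fin (n + 1)) k}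
    (hG : ∀ s, algebraMap _ (RatFunField k n) (G (s, false)) = algebraMap _ _ D * (x s).1 ∧
        algebraMap _ (RatFunField k n) (G (s, true)) = algebraMap _ _ D * (x s).2) :
    algebraMap _ (RatFunField k n) (polyForm (subsetExponent a) (fullExponent a) G) =
      (variablePfister k a).form x * algebraMap _ _ D ^ 2 := by
  rw [variablePfister_form_apply, polyForm, map_sum, Finset.sum_mul]
  refine Finset.sum_congr rfl fun s _ => ?_
  simp only [map_mul, map_add, map_pow, algebraMap_monomial_subsetExponent,
    algebraMap_monomial_fullExponent, (hG s).1, (hG s).2]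
  ring

theorem algebraMap_polyPolar (a : Fin (m + 1) → Fin (n + 1))
    {x y : Finset (Fin m) → RatFunField k n × RatFunField k n} {D D' : MvPolynomial (Fin (n + 1)) k}
    {G H : Finset (Fin m) × Bool → MvPolynomial (Fin (n + 1)) k}
    (hG : ∀ s, algebraMap _ (RatFunField k n) (G (s, false)) = algebraMap _ _ D * (x s).1 ∧
        algebraMap _ (RatFunField k n) (G (s, true)) = algebraMap _ _ D * (x s).2)
    (hH : ∀ s, algebraMap _ (RatFunField k n) (H (s, false)) = algebraMap _ _ D' * (y s).1 ∧
        algebraMap _ (RatFunField k n) (H (s, true)) = algebraMap _ _ D' * (y s).2) :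
    algebraMap _ (RatFunField k n) (polyPolar (subsetExponent a) G H) =
      QuadraticMap.polar (variablePfister k a).form x y *
        (algebraMap _ _ D * algebraMap _ _ D') := by
  rw [variablePfister_polar_apply, polyPolar, map_sum, Finset.sum_mul]
  refine Finset.sum_congr rfl fun s _ => ?_
  simp only [map_mul, map_add, algebraMap_monomial_subsetExponent, (hG s).1, (hG s).2,
    (hH s).1, (hH s).2]
  ring

/-- Polynomial values of the form at nonzero vectors are nonzero, their leading coefficient is a
square, and their leading exponent is even at each variable that does not occur in the form. -/
theorem leadingTerm_of_eq_form (ord : MonomialOrder (Fin (n + 1)))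
    {a : Fin (m + 1) → Fin (n + 1)} (ha : Function.Injective a)
    {x : Finset (Fin m) → RatFunField k n × RatFunField k n} (hx : x ≠ 0)
    {f : MvPolynomial (Fin (n + 1)) k}
    (hf : algebraMap _ (RatFunField k n) f = (variablePfister k a).form x) :
    f ≠ 0 ∧ IsSquare (ord.leadingCoeff f) ∧ ∀ i ∉ Set.range a, Even (ord.degree f i) := by
  have hinj := IsFractionRing.injective (MvPolynomial (Fin (n + 1)) k) (RatFunField k n)
  obtain ⟨D, G, hD, hG⟩ := exists_clear_denominators x
  have hG0 : G ≠ 0 := by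
    rintro rfl
    have hD' := (map_ne_zero_iff _ hinj).2 hD
    refine hx (funext fun s => Prod.ext ?_ ?_)
    · simpa [hD] using (hG s).1
    · simpa [hD] using (hG s).2
  have hmul : polyForm (subsetExponent a) (fullExponent a) G = f * D ^ 2 := hinj (by
    rw [algebraMap_polyForm a hG, map_mul, map_pow, hf])
  obtain ⟨t, h0, hdeg, hlead, -⟩ := exists_leading_entry ord (eq_of_entryExponent_modEq ha)
    (fullExponent_ne_zero ha) hG0
  rw [hmul] at h0 hdeg hlead
  have hf0 : f ≠ 0 := left_ne_zero_of_mul h0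
  refine ⟨hf0, ?_, fun i hi => ?_⟩
  · rw [ord.leadingCoeff_mul, ord.leadingCoeff_pow] at hlead
    have hDl := ord.leadingCoeff_ne_zero_iff.2 hD
    exact ⟨ord.leadingCoeff (G t) / ord.leadingCoeff D, by field_simp; linear_combination hlead⟩
  · have h1 := DFunLike.congr_fun hdeg i
    rw [ord.degree_mul hf0 (pow_ne_zero 2 hD), ord.degree_pow] at h1
    simp only [Finsupp.add_apply, Finsupp.smul_apply, smul_eq_mul,
      entryExponent_apply_of_notMem_range hi] at h1
    rw [Nat.even_iff]
    omega

theorem degree_polar_lt (ord : MonomialOrder (Fin (n + 1)))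
    {a : Fin (m + 1) → Fin (n + 1)} (ha : Function.Injective a)
    {x y : Finset (Fin m) → RatFunField k n × RatFunField k n}
    {f g r : MvPolynomial (Fin (n + 1)) k}
    (hf : algebraMap _ (RatFunField k n) f = (variablePfister k a).form x)
    (hg : algebraMap _ (RatFunField k n) g = (variablePfister k a).form y)
    (hr : algebraMap _ (RatFunField k n) r = QuadraticMap.polar (variablePfister k a).form x y)
    (hr0 : r ≠ 0) : ord.toSyn (2 • ord.degree r) < ord.toSyn (ord.degree f + ord.degree g) := by
  have hinj := IsFractionRing.injective (MvPolynomial (Fin (n + 1)) k) (RatFunField k n)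
  have hx : x ≠ 0 := by
    rintro rfl
    refine hr0 (hinj (hr.trans ?_))
    rw [variablePfister_polar_apply]
    simp
  have hy : y ≠ 0 := by
    rintro rfl
    refine hr0 (hinj (hr.trans ?_))
    rw [variablePfister_polar_apply]
    simp
  have hf0 := (leadingTerm_of_eq_form ord ha hx hf).1
  have hg0 := (leadingTerm_of_eq_form ord ha hy hg).1
  obtain ⟨D, G, hD, hG⟩ := exists_clear_denominators x
  obtain ⟨D', H, hD', hH⟩ := exists_clear_denominators y
  have h1 : polyForm (subsetExponent a) (fullExponent a) G = f * D ^ 2 := hinj (by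
    rw [algebraMap_polyForm a hG, map_mul, map_pow, hf])
  have h2 : polyForm (subsetExponent a) (fullExponent a) H = g * D' ^ 2 := hinj (by
    rw [algebraMap_polyForm a hH, map_mul, map_pow, hg])
  have h3 : polyPolar (subsetExponent a) G H = r * (D * D') := hinj (by
    rw [algebraMap_polyPolar a hG hH, map_mul, map_mul, hr])
  have key := degree_polyPolar_lt ord (eq_of_entryExponent_modEq ha) (fullExponent_ne_zero ha)
    (h3 ▸ mul_ne_zero hr0 (mul_ne_zero hD hD'))
  rw [h1, h2, h3, ord.degree_mul hr0 (mul_ne_zero hD hD'), ord.degree_mul hD hD',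
    ord.degree_mul hf0 (pow_ne_zero 2 hD), ord.degree_mul hg0 (pow_ne_zero 2 hD'),
    ord.degree_pow, ord.degree_pow] at key
  have h4 : 2 • (ord.degree r + (ord.degree D + ord.degree D')) =
      2 • ord.degree r + (2 • ord.degree D + 2 • ord.degree D') := by
    simp only [smul_add]
  have h5 : ord.degree f + 2 • ord.degree D + (ord.degree g + 2 • ord.degree D') =
      ord.degree f + ord.degree g + (2 • ord.degree D + 2 • ord.degree D') :=
    add_add_add_comm _ _ _ _
  rw [h4, h5, map_add, map_add _ (ord.degree f + ord.degree g)] at key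
  exact lt_of_add_lt_add_right key

/-! ### Absence of common subforms -/

theorem not_isometric_variablePfister {i j : Fin (m + 2)} (hij : i ≠ j) :
    ¬ (variablePfister k i.succAbove).Isometric (variablePfister k j.succAbove) := by
  classical
  rintro ⟨e⟩
  let x : Finset (Fin m) → RatFunField k (m + 1) × RatFunField k (m + 1) := Pi.single ∅ (0, 1)
  have hx : (variablePfister k i.succAbove).form x = ∏ l, ratVar k (m + 1) (i.succAbove l) := by
    rw [variablePfister_form_apply, Finset.sum_eq_single ∅]
    · simp [x]
    · intro s _ hs
      simp [x, Pi.single_eq_of_ne hs]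
    · simp
  have hx0 : x ≠ 0 := fun h => by simpa [x] using congrArg Prod.snd (congrFun h ∅)
  have hy0 : e x ≠ 0 := fun h => hx0 (e.toLinearEquiv.map_eq_zero_iff.1 h)
  have hval : algebraMap _ (RatFunField k (m + 1)) (monomial (fullExponent i.succAbove) (1 : k)) =
      (variablePfister k j.succAbove).form (e x) := by
    rw [algebraMap_monomial_fullExponent, ← hx]
    exact (e.map_app x).symm
  obtain ⟨l, rfl⟩ := Fin.exists_succAbove_eq hij.symm
  have h := (leadingTerm_of_eq_form MonomialOrder.lex Fin.succAbove_right_injective hy0 hval).2.2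
    (i.succAbove l) (by rintro ⟨l', hl'⟩; exact Fin.succAbove_ne _ _ hl')
  rw [MonomialOrder.degree_monomial, if_neg one_ne_zero,
    fullExponent_apply Fin.succAbove_right_injective] at h
  exact Nat.not_even_one h

/-- A polynomial that every form `ψᵢ` represents has an even leading exponent, as each variable is
missing from one of the forms; so the descent applies. -/
theorem not_forall_represents (p r : MvPolynomial (Fin (m + 2)) k)
    (y : Fin (m + 2) → MvPolynomial (Fin (m + 2)) k →
      Finset (Fin m) → RatFunField k (m + 1) × RatFunField k (m + 1))
    (hy0 : ∀ i u, y i u ≠ 0)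
    (hy : ∀ i u, algebraMap _ (RatFunField k (m + 1)) (p + u * r + u ^ 2) =
      (variablePfister k i.succAbove).form (y i u))
    (hr : r ≠ 0 → ∀ u, MonomialOrder.lex.toSyn (2 • MonomialOrder.lex.degree r) <
      MonomialOrder.lex.toSyn (MonomialOrder.lex.degree (p + u * r + u ^ 2))) : False := by
  have key := fun i u => leadingTerm_of_eq_form MonomialOrder.lex
    (Fin.succAbove_right_injective (p := i)) (hy0 i u) (hy i u)
  refine no_descent MonomialOrder.lex p r (fun u => (key 0 u).1) (fun u => ?_)
    (fun u => (key 0 u).2.1) hr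
  have heven : ∀ i, Even (MonomialOrder.lex.degree (p + u * r + u ^ 2) i) := fun i =>
    (key i u).2.2 i (by rintro ⟨l, hl⟩; exact Fin.succAbove_ne _ _ hl)
  refine ⟨Finsupp.mapRange (· / 2) rfl (MonomialOrder.lex.degree (p + u * r + u ^ 2)), ?_⟩
  ext i
  have := (heven i).two_dvd
  simp only [Finsupp.smul_apply, Finsupp.mapRange_apply, smul_eq_mul]
  omega

theorem not_forall_isSubform_quadraticOnePfister (c : RatFunField k (m + 1)) :
    ¬ ∀ i : Fin (m + 2),
      IsSubform (quadraticOnePfister c).form (variablePfister k i.succAbove) := by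
  intro h
  choose f hf using h
  obtain ⟨p, q, hq, hpq⟩ := exists_eq_div_sq c
  have hq1 : algebraMap (MvPolynomial (Fin (m + 2)) k) (RatFunField k (m + 1)) q ≠ 0 :=
    (map_ne_zero_iff _ (IsFractionRing.injective _ _)).2 hq
  let A := algebraMap (MvPolynomial (Fin (m + 2)) k) (RatFunField k (m + 1))
  have hform : ∀ i (x : RatFunField k (m + 1) × RatFunField k (m + 1)),
      (variablePfister k i.succAbove).form (f i x) = x.1 ^ 2 + x.1 * x.2 + c * x.2 ^ 2 := by
    intro i x
    refine ((f i).map_app x).trans ((binaryForm_apply _ _ x).trans ?_)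
    rw [one_mul]
  have hy : ∀ i u, A (p + u * q + u ^ 2) =
      (variablePfister k i.succAbove).form (f i (A u, A q)) := by
    intro i u
    rw [hform, map_add, map_add, map_mul, map_pow, hpq]
    ring
  refine not_forall_represents p q (fun i u => f i (A u, A q)) (fun i u h => ?_) hy fun _ u => ?_
  · exact hq1 (congrArg Prod.snd (hf i (h.trans (map_zero (f i).toLinearMap).symm)))
  · -- The vectors with coordinates `(q, 0)` and `(u, q)` have values `q²` and `p + u q + u²`, and
    -- their polar product is `q²`.
    have h1 : A (q ^ 2) = (variablePfister k (Fin.succAbove 0)).form (f 0 (A q, 0)) := by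
      rw [hform, map_pow]
      ring
    have h2 : A (q ^ 2) = QuadraticMap.polar (variablePfister k (Fin.succAbove 0)).form
        (f 0 (A q, 0)) (f 0 (A u, A q)) := by
      have hadd : f 0 (A q, 0) + f 0 (A u, A q) = f 0 (A q + A u, A q) :=
        by
        refine (map_add (f 0).toLinearMap _ _).symm.trans (congrArg (f 0) ?_)
        exact Prod.ext rfl (zero_add _)
      have h2 : (2 : RatFunField k (m + 1)) = 0 := CharTwo.two_eq_zero
      rw [QuadraticMap.polar, hadd, hform, hform, hform, map_pow]
      linear_combination (-A q * A u) * h2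
    have h3 := degree_polar_lt MonomialOrder.lex Fin.succAbove_right_injective h1 (hy 0 u) h2
      (pow_ne_zero 2 hq)
    rw [MonomialOrder.degree_pow, two_nsmul (2 • _), map_add, map_add _ (2 • _)] at h3
    exact lt_of_add_lt_add_left h3

theorem bilinearPfister_one_apply {F : Type u} [Field F] (β : Fin 1 → Fˣ)
    (w : Finset (Fin 1) → F) :
    (bilinearPfister β).toQuadraticMap w = w ∅ ^ 2 + β 0 * w {0} ^ 2 := by
  have huniv : (Finset.univ : Finset (Finset (Fin 1))) = {∅, {0}} := by decide
  rw [LinearMap.BilinMap.toQuadraticMap_apply, bilinearPfister, Matrix.toBilin'_apply']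
  simp only [dotProduct, Matrix.mulVec_diagonal, huniv]
  rw [Finset.sum_pair (by decide)]
  simp [pfisterEntry]
  ring

theorem not_forall_isSubform_bilinearPfister (β : Fin 1 → (RatFunField k (m + 1))ˣ) :
    ¬ ∀ i : Fin (m + 2),
      IsSubform (bilinearPfister β).toQuadraticMap (variablePfister k i.succAbove) := by
  intro h
  choose f hf using h
  obtain ⟨p, q, hq, hpq⟩ := exists_eq_div_sq (β 0 : RatFunField k (m + 1))
  have hq1 : algebraMap (MvPolynomial (Fin (m + 2)) k) (RatFunField k (m + 1)) q ≠ 0 :=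
    (map_ne_zero_iff _ (IsFractionRing.injective _ _)).2 hq
  let A := algebraMap (MvPolynomial (Fin (m + 2)) k) (RatFunField k (m + 1))
  let w : MvPolynomial (Fin (m + 2)) k → Finset (Fin 1) → RatFunField k (m + 1) :=
    fun u s => if s = ∅ then A u else A q
  refine not_forall_represents p 0 (fun i u => f i (w u)) (fun i u h => ?_) (fun i u => ?_)
    (fun h => absurd rfl h)
  · have hw : w u = 0 := hf i (h.trans (map_zero (f i).toLinearMap).symm)
    have hw0 : w u {0} = A q := if_neg (Finset.singleton_ne_empty 0)
    exact hq1 (hw0.symm.trans (congrFun hw {0}))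
  · refine Eq.trans ?_ ((f i).map_app (w u)).symm
    rw [bilinearPfister_one_apply]
    change _ = A u ^ 2 + β 0 * A q ^ 2
    rw [hpq, mul_zero, add_zero, map_add, map_pow]
    exact add_comm _ _

end VariableForms

/-! ### Linkage and subforms -/

section Linkage

variable {F : Type u} [Field F]

theorem IsSubform.of_isometric {W : Type*} [AddCommGroup W] [Module F W] {ρ : QuadraticForm F W}
    {A B : QuadSpace F} (h : IsSubform ρ A) (e : B.Isometric A) : IsSubform ρ B := by
  obtain ⟨f, hf⟩ := h
  obtain ⟨e⟩ := e
  exact ⟨e.symm.toIsometry.comp f, e.symm.injective.comp hf⟩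

theorem IsSubform.pfisterTensor {W : Type*} [AddCommGroup W] [Module F W] {ρ : QuadraticForm F W}
    {A : QuadSpace F} (h : IsSubform ρ A) {m : ℕ} (β : Fin m → Fˣ) :
    IsSubform ρ (A.pfisterTensor β) := by
  classical
  obtain ⟨f, hf⟩ := h
  refine ⟨{ LinearMap.single F (fun _ : Finset (Fin m) => A.V) ∅ ∘ₗ f.toLinearMap with
    map_app' := fun x => ?_ }, fun x y hxy => hf ?_⟩
  · refine (QuadSpace.pfisterTensor_form_apply β A (Pi.single ∅ (f x))).trans ?_
    rw [Finset.sum_eq_single ∅]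
    · simp [pfisterEntry]
    · intro s _ hs
      simp [Pi.single_eq_of_ne hs]
    · simp
  · exact Pi.single_injective (M := fun _ : Finset (Fin m) => A.V) ∅ hxy

theorem isSubform_bilinearPfister_pfisterTensor {A : QuadSpace F} {v : A.V} (hv : A.form v = 1)
    {m : ℕ} (β : Fin (m + 1) → Fˣ) :
    IsSubform (bilinearPfister fun _ : Fin 1 => β 0).toQuadraticMap (A.pfisterTensor β) := by
  classical
  have hv0 : v ≠ 0 := by rintro rfl; simp at hv
  let g : (Finset (Fin 1) → F) →ₗ[F] (Finset (Fin (m + 1)) → A.V) :=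
    LinearMap.single F (fun _ => A.V) ∅ ∘ₗ LinearMap.toSpanSingleton F A.V v ∘ₗ
        LinearMap.proj (φ := fun _ : Finset (Fin 1) => F) ∅ +
      LinearMap.single F (fun _ => A.V) {0} ∘ₗ LinearMap.toSpanSingleton F A.V v ∘ₗ
        LinearMap.proj (φ := fun _ : Finset (Fin 1) => F) {0}
  have h0 : ∀ w, g w ∅ = w ∅ • v := fun w => by simp [g]
  have h1 : ∀ w, g w {0} = w {0} • v := fun w => by simp [g]
  have h2 : ∀ w s, s ≠ ∅ → s ≠ {0} → g w s = 0 := fun w s hs hs' => by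
    simp [g, Pi.single_eq_of_ne hs, Pi.single_eq_of_ne hs']
  refine ⟨{ g with map_app' := fun w => ?_ }, fun w w' hw => ?_⟩
  · refine (QuadSpace.pfisterTensor_form_apply β A (g w)).trans ?_
    rw [bilinearPfister_one_apply, ← Finset.sum_subset (Finset.subset_univ {∅, {0}}),
      Finset.sum_pair (Finset.singleton_ne_empty 0).symm, h0, h1, QuadraticMap.map_smul,
      QuadraticMap.map_smul, hv]
    · simp [pfisterEntry, sq]
    · intro s _ hs
      simp only [Finset.mem_insert, Finset.mem_singleton, not_or] at hs
      rw [h2 w s hs.1 hs.2, QuadraticMap.map_zero, mul_zero]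
  · have hw' : g w = g w' := hw
    have huniv : ∀ s : Finset (Fin 1), s = ∅ ∨ s = {0} := by decide
    funext s
    rcases huniv s with rfl | rfl
    · have := congrFun hw' ∅
      rw [h0, h0] at this
      exact smul_left_injective F hv0 this
    · have := congrFun hw' {0}
      rw [h1, h1] at this
      exact smul_left_injective F hv0 this

variable [CharP F 2]

theorem IsPfister.exists_isSubform {n : ℕ} {A : QuadSpace F} (h : IsPfister n A) :
    ∃ a, IsSubform (quadraticOnePfister a).form A := by
  obtain ⟨m, -, β, a, e⟩ := h
  have hid : IsSubform (quadraticOnePfister a).form (quadraticOnePfister a) :=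
    ⟨QuadraticMap.Isometry.id _, Function.injective_id⟩
  exact ⟨a, (hid.pfisterTensor β).of_isometric e⟩

theorem IsPfister.exists_form_eq_one {n : ℕ} {A : QuadSpace F} (h : IsPfister n A) :
    ∃ v, A.form v = 1 := by
  obtain ⟨a, f, -⟩ := h.exists_isSubform
  refine ⟨f (1, 0), (f.map_app (1, 0)).trans ((binaryForm_apply _ _ _).trans ?_)⟩
  simp

end Linkage

end PfisterLinkage

open PfisterLinkage in
theorem mainTheorem1 (k : Type u) [Field k] [CharP k 2] (n : ℕ) (hn : 2 ≤ n) :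
    (∀ i, IsPfister n (omitForm k n i)) ∧
    (∀ i j, i ≠ j → ¬ (omitForm k n i).Isometric (omitForm k n j)) ∧
    IsStronglyTight n (Set.range (omitForm k n)) ∧
    (¬ ∃ a : RatFunField k n, ∀ i, IsSubform (quadraticOnePfister a).form (omitForm k n i)) ∧
    (¬ ∃ β : Fin 1 → (RatFunField k n)ˣ,
      ∀ i, IsSubform (bilinearPfister β).toQuadraticMap (omitForm k n i)) ∧
    ¬ IsLeftLinked (n - 1) 1 (Set.range (omitForm k n)) ∧
    ¬ IsRightLinked 1 (n - 1) (Set.range (omitForm k n)) := by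
  obtain ⟨m, rfl⟩ : ∃ m, n = m + 2 := ⟨n - 2, by omega⟩
  have hquad : ¬ ∃ a : RatFunField k (m + 2),
      ∀ i, IsSubform (quadraticOnePfister a).form (omitForm k (m + 2) i) := by
    rintro ⟨a, h⟩
    exact not_forall_isSubform_quadraticOnePfister a fun i =>
      omitForm_eq_variablePfister (k := k) i ▸ h i
  have hbil : ¬ ∃ β : Fin 1 → (RatFunField k (m + 2))ˣ,
      ∀ i, IsSubform (bilinearPfister β).toQuadraticMap (omitForm k (m + 2) i) := by
    rintro ⟨β, h⟩
    exact not_forall_isSubform_bilinearPfister β fun i =>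
      omitForm_eq_variablePfister (k := k) i ▸ h i
  refine ⟨fun i => isPfister_symbol _, fun i j hij h => ?_,
    isStronglyTight_range_symbol_succAbove (ratVar k (m + 2)), hquad, hbil, ?_, ?_⟩
  · rw [omitForm_eq_variablePfister, omitForm_eq_variablePfister] at h
    exact not_isometric_variablePfister hij h
  · rintro ⟨β, h⟩
    refine hbil ⟨fun _ => β (0 : Fin (m + 1)), fun i => ?_⟩
    obtain ⟨φ, hφ, e⟩ := h _ ⟨i, rfl⟩
    obtain ⟨v, hv⟩ := hφ.exists_form_eq_one
    exact (isSubform_bilinearPfister_pfisterTensor hv β).of_isometric e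
  · rintro ⟨φ, hφ, h⟩
    obtain ⟨a, ha⟩ := hφ.exists_isSubform
    refine hquad ⟨a, fun i => ?_⟩
    obtain ⟨β, e⟩ := h _ ⟨i, rfl⟩
    exact (ha.pfisterTensor β).of_isometric e
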